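/- Let $\mathfrak o$ be a complete discrete valuation ring with finite residue field of characteristic two, maximal ideal $\wp$ and uniformizer $\pi$, and put $\mathfrak o_n=\mathfrak o/\wp^n$. Let $\mathbf R_{\mathfrak o}=4e$ if $\mathfrak o$ has characteristic $0$ and ramification index $e$ (that is, $2\mathfrak o=\wp^e$), and $\mathbf R_{\mathfrak o}=2$ if $\mathfrak o$ has characteristic $2$. Let $\ell$ be such that $r=2\ell\ge\mathbf R_{\mathfrak o}$, and let $\psi:\mathfrak o_{2\ell}\to\mathbb C^\times$ be an additive character with $\psi(\pi^{2\ell-1})\ne 1$. Let $M^\ell=\ker(\mathrm{GL}_2(\mathfrak o_{2\ell})\to\mathrm{GL}_2(\mathfrak o_\ell))$ and $K^\ell=M^\ell\cap\mathrm{SL}_2(\mathfrak o_{2\ell})$. For $A\in M_2(\mathfrak o_\ell)$ with a lift $\hat A\in M_2(\mathfrak o_{2\ell})$, let $\psi_A$ be the (well-defined) one-dimensional representation $\psi_A(I+\pi^\ell B)=\psi(\pi^\ell\,\mathrm{tr}(\hat AB))$ of $M^\ell$, and let $\psi_{[A]}=\psi_A|_{K^\ell}$. Write $C_S(\psi_A)$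 and $C_S(\psi_{[A]})$ for the stabilizers of $\psi_A$ and $\psi_{[A]}$ in $S=\mathrm{SL}_2(\mathfrak o_{2\ell})$ acting by conjugation. For $K^\ell\le H\le S$ let $\mathrm{Irr}(H\mid\psi_{[A]})$ be the set of isomorphism classes of irreducible complex representations of $H$ that are constituents of $\mathrm{Ind}_{K^\ell}^H\psi_{[A]}$. The matrix $A$ is called cyclic if there is a vector $v\in\mathfrak o_\ell^2$ such that $\{v,Av\}$ generates $\mathfrak o_\ell^2$. Then for every cyclic $A\in M_2(\mathfrak o_\ell)$ there exists a unique normal subgroup $\mathbb M_A$ of $C_S(\psi_{[A]})$ such that $C_S(\psi_A)\subseteq\mathbb M_A$ and the following hold. 1. The character $\psi_{[A]}$ of $K^\ell$ extends to a one-dimensional representation of $\mathbb M_A$. 2. For every $\rho\in\mathrm{Irr}(\mathbb M_A\mid\psi_{[A]})$ the induced representation $\mathrm{Ind}_{\mathbb M_A}^{S}(\rho)$ is irreducible. 3. For every $\delta\in\mathrm{Irr}(S\mid\psi_{[A]})$ there exists $\rho\in\mathrm{Irr}(\mathbb M_A\mid\psi_{[A]})$ with $\delta\cong\mathrm{Ind}_{\mathbb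 M_A}^{S}(\rho)$. 4. The group $\mathbb M_A/K^\ell$ is either abelian or a semidirect product $B\rtimes D$ of an abelian normal subgroup $B$ with a group $D$ of order two. 5. Every $\rho\in\mathrm{Irr}(\mathbb M_A\mid\psi_{[A]})$ has dimension one or two. 6. The set of equivalence classes of $\mathrm{Irr}(\mathbb M_A\mid\psi_{[A]})$ under the conjugation action of $C_S(\psi_{[A]})$ is in bijective correspondence with $\mathrm{Irr}(S\mid\psi_{[A]})$. Moreover, the correspondence in (6) is realized by induction: $\rho\mapsto\mathrm{Ind}_{\mathbb M_A}^{S}(\rho)$ induces a bijection between these two sets. -/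

import Mathlib

open IsLocalRing

noncomputable section

section CliffordTheory

variable {G : Type*} [Group G]

/-- The inertia group (stabilizer) `C_G(χ) = {g ∈ G | χ^g = χ}` of a one-dimensional
representation `χ` of a normal subgroup `N` of `G`, where `χ^g(n) = χ(g n g⁻¹)`. -/
def inertiaGroup {N : Subgroup G} [N.Normal] (χ : N →* ℂˣ) : Subgroup G where
  carrier := {g | ∀ n : N, χ (MulAut.conjNormal g n) = χ n}
  one_mem' := by intro n; simp
  mul_mem' := by
    intro g h hg hh n
    rw [map_mul, MulAut.mul_apply]
    exact (hg _).trans (hh n)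
  inv_mem' := by
    intro g hg n
    have h := hg (MulAut.conjNormal g⁻¹ n)
    rw [← MulAut.mul_apply, ← map_mul, mul_inv_cancel, map_one, MulAut.one_apply] at h
    exact h.symm

/-- The one-dimensional complex representation (on `ℂ`) attached to a linear character. -/
def charRep {H : Type*} [Group H] (χ : H →* ℂˣ) : Representation ℂ H ℂ :=
  (Algebra.lmul ℂ ℂ : ℂ →* Module.End ℂ ℂ).comp ((Units.coeHom ℂ).comp χ)

/-- `Irr(H | χ)` before passing to isomorphism classes, for a linear character `χ` of a subgroup
`K` of `G` and a group `H` with a homomorphism `f : H → G` (in use, `f` is the inclusion of a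
subgroup `H` containing `K`, so that `K.comap f` is just `K` seen as a subgroup of `H`):
the irreducible complex representations of `H` that are constituents of the representation induced
from `χ`, i.e. are isomorphic to a subrepresentation of it.  The groups in use are finite, hence
every irreducible representation has a model on a vector space in `Type`. -/
structure IrrOver {K : Subgroup G} (χ : K →* ℂˣ) {H : Type*} [Group H] (f : H →* G) where
  /-- the representation -/
  rep : Rep.{0} ℂ H
  irreducible : rep.ρ.IsIrreducible
  constituent : ∃ T : rep.ρ.IntertwiningMap
    (Representation.ind (K.comap f).subtype (charRep (χ.comp (f.subgroupComap K)))),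
    Function.Injective T

/-- Isomorphism of representations, on `Irr(H | χ)`. -/
def isoSetoid {K : Subgroup G} (χ : K →* ℂˣ) {H : Type*} [Group H] (f : H →* G) :
    Setoid (IrrOver χ f) where
  r ρ₁ ρ₂ := Nonempty (ρ₁.rep.ρ.Equiv ρ₂.rep.ρ)
  iseqv :=
    { refl := fun _ => ⟨.refl _⟩
      symm := fun ⟨e⟩ => ⟨e.symm⟩
      trans := fun ⟨e⟩ ⟨e'⟩ => ⟨e.trans e'⟩ }

variable {K : Subgroup G} [K.Normal]

/-- The inclusion into `G` of a subgroup `M` of the inertia group of `χ`. -/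
abbrev inclG {χ : K →* ℂˣ} (M : Subgroup (inertiaGroup χ)) : M →* G :=
  (inertiaGroup χ).subtype.comp M.subtype

/-- `ρ₁` is isomorphic to the conjugate `ρ₂^g`, `ρ₂^g(m) = ρ₂(g m g⁻¹)`, for some `g ∈ S`, where
`ρ₁` and `ρ₂` are representations of a normal subgroup `M` of `S`. -/
def IsConjRep {S : Type*} [Group S] {M : Subgroup S} [M.Normal] {V W : Type*} [AddCommGroup V]
    [Module ℂ V] [AddCommGroup W] [Module ℂ W] (ρ₁ : Representation ℂ M V)
    (ρ₂ : Representation ℂ M W) : Prop :=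
  ∃ (g : S) (T : V ≃ₗ[ℂ] W), ∀ (m : M) (v : V), T (ρ₁ m v) = ρ₂ (MulAut.conjNormal g m) (T v)

section

variable {S : Type*} [Group S] {M : Subgroup S} [M.Normal] {V W U : Type*}
  [AddCommGroup V] [Module ℂ V] [AddCommGroup W] [Module ℂ W] [AddCommGroup U] [Module ℂ U]
  {ρ₁ : Representation ℂ M V} {ρ₂ : Representation ℂ M W} {ρ₃ : Representation ℂ M U}

theorem IsConjRep.rfl' : IsConjRep ρ₁ ρ₁ :=
  ⟨1, .refl ℂ V, fun m v => by rw [map_one, MulAut.one_apply]; rfl⟩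

theorem IsConjRep.symm' (h : IsConjRep ρ₁ ρ₂) : IsConjRep ρ₂ ρ₁ := by
  obtain ⟨g, T, hT⟩ := h
  refine ⟨g⁻¹, T.symm, fun m v => ?_⟩
  rw [LinearEquiv.symm_apply_eq, hT, ← MulAut.mul_apply, ← map_mul, mul_inv_cancel,
    map_one, MulAut.one_apply, LinearEquiv.apply_symm_apply]

theorem IsConjRep.trans' (h : IsConjRep ρ₁ ρ₂) (h' : IsConjRep ρ₂ ρ₃) : IsConjRep ρ₁ ρ₃ := by
  obtain ⟨g, T, hT⟩ := h
  obtain ⟨g', T', hT'⟩ := h'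
  refine ⟨g' * g, T.trans T', fun m v => ?_⟩
  rw [LinearEquiv.trans_apply, hT, hT', map_mul, MulAut.mul_apply, LinearEquiv.trans_apply]

end

/-- Equivalence under the conjugation action of the inertia group `C_G(χ)` on (isomorphism classes
in) `Irr(M | χ)`, for `M` a normal subgroup of `C_G(χ)`. -/
def conjSetoid (χ : K →* ℂˣ) (M : Subgroup (inertiaGroup χ)) [M.Normal] :
    Setoid (IrrOver χ (inclG M)) where
  r ρ₁ ρ₂ := IsConjRep ρ₁.rep.ρ ρ₂.rep.ρ
  iseqv := ⟨fun _ => IsConjRep.rfl', IsConjRep.symm', IsConjRep.trans'⟩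

/-- The properties characterizing the subgroup in the theorem.  Here `C` is a subgroup of `G`,
`χ` is a linear character of the normal subgroup `K` of `G`, and `M` is a subgroup of the inertia
group `C_G(χ)`. -/
structure IsCliffordSubgroup (C : Subgroup G) (χ : K →* ℂˣ) (M : Subgroup (inertiaGroup χ)) :
    Prop where
  /-- `M` is normal in `C_G(χ)`. -/
  [normal : M.Normal]
  /-- `C ⊆ M`. -/
  le : C ≤ M.map (inertiaGroup χ).subtype
  /-- `χ` extends to a one-dimensional representation of `M`. -/
  extends_char : ∃ χ' : M →* ℂˣ, ∀ (m : M) (hm : inclG M m ∈ K), χ' m = χ ⟨inclG M m, hm⟩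
  /-- Every element of `Irr(M | χ)` induces irreducibly to `G`. -/
  ind_irreducible : ∀ ρ : IrrOver χ (inclG M), (ρ.rep.ρ.ind (inclG M)).IsIrreducible
  /-- Every element of `Irr(G | χ)` is induced from an element of `Irr(M | χ)`. -/
  ind_surjective : ∀ δ : IrrOver χ (MonoidHom.id G), ∃ ρ : IrrOver χ (inclG M),
    Nonempty (δ.rep.ρ.Equiv (ρ.rep.ρ.ind (inclG M)))
  /-- `M / K` is abelian, or the (internal) semidirect product of an abelian normal subgroup and a
  subgroup of order two. -/
  quotient_structure :
    (∀ x y : M ⧸ K.comap (inclG M), x * y = y * x) ∨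
    ∃ B D : Subgroup (M ⧸ K.comap (inclG M)),
      B.Normal ∧ (∀ x ∈ B, ∀ y ∈ B, x * y = y * x) ∧ Nat.card D = 2 ∧ B.IsComplement' D
  /-- Every element of `Irr(M | χ)` has dimension one or two. -/
  dim_one_or_two : ∀ ρ : IrrOver χ (inclG M),
    Module.finrank ℂ ρ.rep = 1 ∨ Module.finrank ℂ ρ.rep = 2
  /-- The classes of `Irr(M | χ)` under conjugation by `C_G(χ)` biject with `Irr(G | χ)`. -/
  bijection : Nonempty
    (Quotient (conjSetoid χ M) ≃ Quotient (isoSetoid χ (MonoidHom.id G)))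

/-- Induction `ρ ↦ Ind_M^G ρ` induces a bijection from the classes of `Irr(M | χ)` under
conjugation by `C_G(χ)` onto `Irr(G | χ)`. -/
def InductionBijective (χ : K →* ℂˣ) (M : Subgroup (inertiaGroup χ)) [M.Normal] : Prop :=
  ∃ Φ : Quotient (conjSetoid χ M) ≃ Quotient (isoSetoid χ (MonoidHom.id G)),
    ∀ (ρ : IrrOver χ (inclG M)) (δ : IrrOver χ (MonoidHom.id G)),
      Φ (Quotient.mk _ ρ) = Quotient.mk _ δ ↔ Nonempty (δ.rep.ρ.Equiv (ρ.rep.ρ.ind (inclG M)))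

end CliffordTheory

section Matrices

/-- `A` is cyclic: `{v, A v}` generates the free module `R²` for some vector `v`. -/
def IsCyclicMatrix {R : Type*} [CommRing R] (A : Matrix (Fin 2) (Fin 2) R) : Prop :=
  ∃ v : Fin 2 → R, Submodule.span R {v, A.mulVec v} = ⊤

variable (𝒪 : Type*) [CommRing 𝒪] [IsLocalRing 𝒪]

/-- `𝔬_n = 𝔬 / ℘^n`. -/
abbrev TruncRing (n : ℕ) : Type _ := 𝒪 ⧸ maximalIdeal 𝒪 ^ n

/-- The projection `𝔬_{2ℓ} → 𝔬_ℓ`. -/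
abbrev truncMap (ℓ : ℕ) : TruncRing 𝒪 (2 * ℓ) →+* TruncRing 𝒪 ℓ :=
  Ideal.Quotient.factor (Ideal.pow_le_pow_right (by omega))

variable {𝒪}

theorem truncMap_surjective (ℓ : ℕ) : Function.Surjective (truncMap 𝒪 ℓ) :=
  Ideal.Quotient.factor_surjective _

theorem mul_eq_zero_of_truncMap {ℓ : ℕ} {a b : TruncRing 𝒪 (2 * ℓ)}
    (ha : truncMap 𝒪 ℓ a = 0) (hb : truncMap 𝒪 ℓ b = 0) : a * b = 0 := by
  obtain ⟨x, rfl⟩ := Ideal.Quotient.mk_surjective a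
  obtain ⟨y, rfl⟩ := Ideal.Quotient.mk_surjective b
  rw [Ideal.Quotient.factor_mk, Ideal.Quotient.eq_zero_iff_mem] at ha hb
  rw [← map_mul, Ideal.Quotient.eq_zero_iff_mem, two_mul, pow_add]
  exact Ideal.mul_mem_mul ha hb

variable (𝒪)

/-- The congruence subgroup `M^ℓ = ker(GL₂(𝔬_{2ℓ}) → GL₂(𝔬_ℓ))`. -/
abbrev congGL (ℓ : ℕ) : Subgroup (GL (Fin 2) (TruncRing 𝒪 (2 * ℓ))) :=
  (Matrix.GeneralLinearGroup.map (truncMap 𝒪 ℓ)).ker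

/-- The congruence subgroup `K^ℓ = M^ℓ ∩ SL₂(𝔬_{2ℓ})`. -/
abbrev congSL (ℓ : ℕ) : Subgroup (Matrix.SpecialLinearGroup (Fin 2) (TruncRing 𝒪 (2 * ℓ))) :=
  (congGL 𝒪 ℓ).comap Matrix.SpecialLinearGroup.toGL

variable {𝒪}

/-- A lift of `A ∈ M₂(𝔬_ℓ)` to `M₂(𝔬_{2ℓ})`. -/
def liftMatrix {ℓ : ℕ} (A : Matrix (Fin 2) (Fin 2) (TruncRing 𝒪 ℓ)) :
    Matrix (Fin 2) (Fin 2) (TruncRing 𝒪 (2 * ℓ)) :=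
  A.map (Function.surjInv (truncMap_surjective ℓ))

theorem congGL_sub_one {ℓ : ℕ} (X : congGL 𝒪 ℓ) (i j : Fin 2) :
    truncMap 𝒪 ℓ ((X.1.1 - 1) i j) = 0 := by
  have h := X.2
  rw [MonoidHom.mem_ker] at h
  have h' := congrArg
    (fun Z : GL (Fin 2) (TruncRing 𝒪 ℓ) => Z.1 i j) h
  change truncMap 𝒪 ℓ (X.1.1 i j) = (1 : Matrix (Fin 2) (Fin 2) (TruncRing 𝒪 ℓ)) i j at h'
  rw [Matrix.sub_apply, map_sub, h', sub_eq_zero, Matrix.one_apply, Matrix.one_apply]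
  split_ifs <;> simp

/-- The character `ψ_A` of `M^ℓ`: `ψ_A(I + π^ℓ B) = ψ(π^ℓ tr(Â B))`, that is,
`ψ_A(X) = ψ(tr(Â (X - I)))`, where `Â` is a lift of `A`. -/
def psiA {ℓ : ℕ} (ψ : AddChar (TruncRing 𝒪 (2 * ℓ)) ℂˣ)
    (A : Matrix (Fin 2) (Fin 2) (TruncRing 𝒪 ℓ)) : congGL 𝒪 ℓ →* ℂˣ where
  toFun X := ψ (Matrix.trace (liftMatrix A *
    (X.1.1 - 1)))
  map_one' := by simp
  map_mul' X Y := by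
    rw [← AddChar.map_add_eq_mul, ← Matrix.trace_add, ← Matrix.mul_add]
    congr 3
    have h : (X.1.1 - 1) *
        (Y.1.1 - 1) = 0 := by
      ext i j
      rw [Matrix.mul_apply]
      exact Finset.sum_eq_zero fun k _ =>
        mul_eq_zero_of_truncMap (congGL_sub_one X i k) (congGL_sub_one Y k j)
    have h' : ((X * Y : congGL 𝒪 ℓ) : GL (Fin 2) (TruncRing 𝒪 (2 * ℓ))).1 =
        X.1.1 * Y.1.1 := rfl
    rw [h', ← sub_eq_zero, ← h]
    noncomm_ring

/-- `psiA` is given by the formula `ψ_A(I + π^ℓ B) = ψ(π^ℓ tr(Â B))` for every lift `Â`. -/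
theorem psiA_apply {ℓ : ℕ} (ψ : AddChar (TruncRing 𝒪 (2 * ℓ)) ℂˣ)
    (A : Matrix (Fin 2) (Fin 2) (TruncRing 𝒪 ℓ)) (X : congGL 𝒪 ℓ)
    (A' B : Matrix (Fin 2) (Fin 2) (TruncRing 𝒪 (2 * ℓ))) (hA' : A'.map (truncMap 𝒪 ℓ) = A)
    (p : 𝒪)
    (hX : X.1.1 = 1 + (Ideal.Quotient.mk _ (p ^ ℓ) : TruncRing 𝒪 (2 * ℓ)) • B) :
    psiA ψ A X = ψ (Ideal.Quotient.mk _ (p ^ ℓ) * Matrix.trace (A' * B)) := by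
  have hA : (liftMatrix A - A') *
      (X.1.1 - 1) = 0 := by
    ext i j
    rw [Matrix.mul_apply]
    refine Finset.sum_eq_zero fun k _ => mul_eq_zero_of_truncMap ?_ (congGL_sub_one X k j)
    rw [Matrix.sub_apply, map_sub, sub_eq_zero, ← hA']
    exact Function.surjInv_eq (truncMap_surjective ℓ) _
  rw [Matrix.sub_mul, sub_eq_zero] at hA
  change ψ (Matrix.trace (liftMatrix A * _)) = _
  rw [hA, hX, add_sub_cancel_left, Matrix.mul_smul, Matrix.trace_smul, smul_eq_mul]

/-- The character `ψ_{[A]}` of `K^ℓ`: the restriction of `ψ_A`. -/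
def psiBracket {ℓ : ℕ} (ψ : AddChar (TruncRing 𝒪 (2 * ℓ)) ℂˣ)
    (A : Matrix (Fin 2) (Fin 2) (TruncRing 𝒪 ℓ)) : congSL 𝒪 ℓ →* ℂˣ :=
  (psiA ψ A).comp (Matrix.SpecialLinearGroup.toGL.subgroupComap (congGL 𝒪 ℓ))

/-- `C_{SL₂(𝔬_{2ℓ})}(ψ_A)`: the elements of `SL₂(𝔬_{2ℓ})` stabilizing the character `ψ_A` of
`M^ℓ`. -/
def stabSL {ℓ : ℕ} (ψ : AddChar (TruncRing 𝒪 (2 * ℓ)) ℂˣ)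
    (A : Matrix (Fin 2) (Fin 2) (TruncRing 𝒪 ℓ)) :
    Subgroup (Matrix.SpecialLinearGroup (Fin 2) (TruncRing 𝒪 (2 * ℓ))) :=
  (inertiaGroup (psiA ψ A)).comap Matrix.SpecialLinearGroup.toGL

end Matrices

/-- The bound `R_𝔬`: it is `4e` if `𝔬` has characteristic zero and ramification index `e`
(the valuation of `2`, so that `2𝔬 = ℘^e`), and `2` if `𝔬` has characteristic two. -/
def boundR (𝒪 : Type*) [CommRing 𝒪] [IsDomain 𝒪] [IsDiscreteValuationRing 𝒪] : ℕ :=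
  if ringChar 𝒪 = 0 then 4 * (IsDiscreteValuationRing.addVal 𝒪 (2 : 𝒪)).toNat else 2

end

/-!
Let `N = C_S(ψ_A)`. After conjugating `A` to a companion matrix with trace `t`, the elements of `N`
commute modulo `K^ℓ`, and `ψ_{[A]}` is trivial on their commutators, so it extends to `N`, and every
element of `Irr(N | ψ_{[A]})` is such an extension. An element of `C_S(ψ_{[A]})` conjugates `A + y`
to `A` for some scalar `y`; comparing traces and determinants gives `2y = 0` and `y² + ty = 0`, so
the cosets of `N` in `C_S(ψ_{[A]})` are represented by commuting unipotent matrices whose squares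
lie in `K^ℓ`. Such a coset fixes an extension of `ψ_{[A]}` to `N` only if `ψ_{[A]}` is trivial on
its commutators with `N` that lie in `K^ℓ`. Testing this on the elements `1 + s(g - 1)` with `g` in
`N` and `s` of critical valuation, corrected to have determinant one, shows that a coset with this
property that does not commute with `N` modulo `K^ℓ` is the only nontrivial one. Hence there is a
largest stabilizer `𝕄_A` of an extension, it is abelian modulo `K^ℓ` or contains `N` with index two,
and the rest is Clifford theory over `N`.
-/

noncomputable section

section Representations

open Representation

variable {k G H V W : Type*} [Field k] [Group G] [Group H] [AddCommGroup V] [Module k V]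
  [AddCommGroup W] [Module k W] {ρ : Representation k G V}

theorem nontrivial_of_isIrreducible (ρ : Representation k G V) [ρ.IsIrreducible] :
    Nontrivial V := by
  by_contra h
  rw [not_nontrivial_iff_subsingleton] at h
  exact bot_ne_top (α := Subrepresentation ρ)
    (Subrepresentation.toSubmodule_injective (Subsingleton.elim _ _))

theorem mem_of_mem_of_isIrreducible [ρ.IsIrreducible] (U : Subrepresentation ρ) {v : V}
    (hv : v ∈ U.toSubmodule) (hv₀ : v ≠ 0) (w : V) : w ∈ U.toSubmodule := by
  rcases eq_bot_or_eq_top U with rfl | rfl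
  · exact absurd ((Submodule.mem_bot k).1 hv) hv₀
  · exact Submodule.mem_top

theorem isIrreducible_of_forall_mem [Nontrivial V]
    (h : ∀ U : Subrepresentation ρ, ∀ v ∈ U.toSubmodule, v ≠ 0 → ∀ w, w ∈ U.toSubmodule) :
    ρ.IsIrreducible where
  exists_pair_ne := by
    obtain ⟨v, hv⟩ := exists_ne (0 : V)
    refine ⟨⊥, ⊤, fun hbt => hv ((Submodule.mem_bot k).1 ?_)⟩
    change v ∈ (⊥ : Subrepresentation ρ).toSubmodule
    exact hbt ▸ Submodule.mem_top
  eq_bot_or_eq_top U := by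
    refine or_iff_not_imp_left.2 fun hU => ?_
    obtain ⟨v, hv, hv₀⟩ := Submodule.exists_mem_ne_zero_of_ne_bot
      fun hb => hU (Subrepresentation.toSubmodule_injective hb)
    exact Subrepresentation.toSubmodule_injective (Submodule.eq_top_iff'.2 (h U v hv hv₀))

theorem isIrreducible_of_equivariant {σ : Representation k H W} [ρ.IsIrreducible] (f : G → H)
    (e : V ≃ₗ[k] W) (he : ∀ g v, e (ρ g v) = σ (f g) (e v)) :
    σ.IsIrreducible := by
  have := nontrivial_of_isIrreducible ρ
  have := e.symm.toEquiv.nontrivial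
  refine isIrreducible_of_forall_mem fun U w hw hw₀ x => ?_
  let U' : Subrepresentation ρ :=
    { toSubmodule := U.toSubmodule.comap e.toLinearMap
      apply_mem_toSubmodule := fun g v hv => by
        simpa only [Submodule.mem_comap, LinearEquiv.coe_coe, he]
          using U.apply_mem_toSubmodule (f g) hv }
  have hw' : e.symm w ∈ U'.toSubmodule := by simpa [U'] using hw
  simpa [U'] using mem_of_mem_of_isIrreducible U' hw' (by simpa using hw₀) (e.symm x)

theorem span_orbit_eq_top [ρ.IsIrreducible] {v : V} (hv₀ : v ≠ 0) :
    Submodule.span k (Set.range fun g => ρ g v) = ⊤ := by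
  let U : Subrepresentation ρ :=
    { toSubmodule := Submodule.span k (Set.range fun g => ρ g v)
      apply_mem_toSubmodule := fun g => by
        change _ ≤ (Submodule.span k _).comap (ρ g)
        rw [Submodule.span_le]
        rintro _ ⟨g', rfl⟩
        exact Submodule.subset_span ⟨g * g', by simp⟩ }
  have hvU : v ∈ U.toSubmodule := Submodule.subset_span ⟨1, by simp⟩
  exact Submodule.eq_top_iff'.2 (mem_of_mem_of_isIrreducible U hvU hv₀)

theorem finrank_le_card_of_apply_mem_span [ρ.IsIrreducible] {v : V} (hv₀ : v ≠ 0) {s : Finset V}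
    (h : ∀ g, ρ g v ∈ Submodule.span k (s : Set V)) : Module.finrank k V ≤ s.card := by
  have hs : Submodule.span k (s : Set V) = ⊤ := by
    rw [eq_top_iff, ← span_orbit_eq_top (ρ := ρ) hv₀, Submodule.span_le]
    rintro _ ⟨g, rfl⟩
    exact h g
  rw [← finrank_top, ← hs]
  exact finrank_span_finset_le_card s

theorem finiteDimensional_of_isIrreducible [Finite G] (ρ : Representation k G V)
    [ρ.IsIrreducible] : FiniteDimensional k V := by
  have := nontrivial_of_isIrreducible ρ
  obtain ⟨v, hv⟩ := exists_ne (0 : V)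
  exact ⟨span_orbit_eq_top (ρ := ρ) hv ▸ Submodule.fg_span (Set.finite_range fun g => ρ g v)⟩

theorem exists_isIrreducible_toRepresentation_of_ne_bot [FiniteDimensional k V]
    {U : Subrepresentation ρ} (hU : U ≠ ⊥) :
    ∃ U' ≤ U, U'.toRepresentation.IsIrreducible := by
  have hmono : StrictMono (Subrepresentation.toSubmodule (ρ := ρ)) := fun _ _ h => h
  have := isAtomic_of_orderBot_wellFounded_lt hmono.wellFoundedLT.wf
  obtain ⟨A, hA, hAU⟩ := (eq_bot_or_exists_atom_le U).resolve_left hU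
  have : Nontrivial A.toSubmodule := (Submodule.nontrivial_iff_ne_bot).2
    fun h => hA.1 (Subrepresentation.toSubmodule_injective h)
  refine ⟨A, hAU, isIrreducible_of_forall_mem fun B v hv hv₀ x => ?_⟩
  let B' : Subrepresentation ρ :=
    { toSubmodule := B.toSubmodule.map A.toSubmodule.subtype
      apply_mem_toSubmodule := by
        rintro g _ ⟨w, hw, rfl⟩
        exact ⟨A.toRepresentation g w, B.apply_mem_toSubmodule g hw, rfl⟩ }
  have hB' : B' = A := by
    refine (hA.le_iff.1 (Submodule.map_subtype_le A.toSubmodule B.toSubmodule)).resolve_left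
      fun h => hv₀ (Subtype.ext ?_)
    have hmem : (v : V) ∈ B'.toSubmodule := ⟨v, hv, rfl⟩
    rw [h] at hmem
    exact (Submodule.mem_bot k).1 hmem
  have hx : (x : V) ∈ B'.toSubmodule := by
    rw [hB']
    exact x.2
  obtain ⟨y, hy, hyx⟩ := hx
  rwa [← Subtype.ext hyx]

theorem exists_apply_eq_smul_of_isIrreducible [Finite G] [IsAlgClosed k] [ρ.IsIrreducible]
    (T : IntertwiningMap ρ ρ) : ∃ c : k, ∀ v, T v = c • v := by
  have := finiteDimensional_of_isIrreducible ρ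
  obtain ⟨c, rfl⟩ := (IsIrreducible.algebraMap_intertwiningMap_bijective_of_isAlgClosed
    (ρ := ρ)).surjective T
  exact ⟨c, fun v => rfl⟩

end Representations

section Eigencharacters

variable {k N G V W : Type*} [Field k] [Group N] [Group G] [AddCommGroup V] [Module k V]
  [AddCommGroup W] [Module k W]

/-- The space of vectors on which `N` acts through the linear character `χ`. -/
def charEigenspace (ρ : Representation k N V) (χ : N →* kˣ) : Submodule k V where
  carrier := {v | ∀ n, ρ n v = χ n • v}
  add_mem' hv hw n := by rw [map_add, hv n, hw n, smul_add]
  zero_mem' n := by rw [map_zero, smul_zero]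
  smul_mem' c v hv n := by rw [map_smul, hv n, smul_comm]

/-- The average of `χ(n)⁻¹ ρ(n)` over `N`, not divided by `|N|`: it maps onto the eigenspace of
`χ` and acts on it as multiplication by `|N|`. -/
def charProjector [Fintype N] (ρ : Representation k N V) (χ : N →* kˣ) : V →ₗ[k] V :=
  ∑ n, (χ n)⁻¹ • ρ n

section

variable [Fintype N] {ρ : Representation k N V} {σ : Representation k N W} {χ θ : N →* kˣ}

theorem charProjector_apply (v : V) : charProjector ρ χ v = ∑ n, (χ n)⁻¹ • ρ n v := by
  simp only [charProjector, LinearMap.sum_apply, LinearMap.smul_apply]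

theorem charProjector_mem_charEigenspace (v : V) :
    charProjector ρ χ v ∈ charEigenspace ρ χ := by
  intro m
  simp only [charProjector_apply, map_sum, Finset.smul_sum]
  refine Fintype.sum_equiv (Equiv.mulLeft m) _ _ fun n => ?_
  rw [Equiv.coe_mulLeft, map_mul, mul_inv_rev, map_mul, Module.End.mul_apply, smul_smul,
    mul_comm (χ n)⁻¹, mul_inv_cancel_left]
  exact LinearMap.map_smul_of_tower (ρ m) _ _

theorem charProjector_apply_of_mem {v : V} (hv : v ∈ charEigenspace ρ χ) :
    charProjector ρ χ v = Fintype.card N • v := by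
  simp_rw [charProjector_apply, hv _, inv_smul_smul, Finset.sum_const, Finset.card_univ]

theorem charProjector_apply_eq_zero {v : V} (hv : v ∈ charEigenspace ρ θ) (h : θ ≠ χ) :
    charProjector ρ χ v = 0 := by
  have hne : (Units.coeHom k).comp (χ⁻¹ * θ) ≠ 1 := fun h₁ => h <| MonoidHom.ext fun n =>
    (inv_mul_eq_one.1 (Units.ext (DFunLike.congr_fun h₁ n))).symm
  simp_rw [charProjector_apply, hv _, smul_smul, Units.smul_def, ← Finset.sum_smul]
  rw [show ∑ n, (((χ n)⁻¹ * θ n : kˣ) : k) = 0 from sum_hom_units_eq_zero _ hne, zero_smul]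

theorem map_charProjector (T : V →ₗ[k] W) (hT : ∀ n v, T (ρ n v) = σ n (T v)) (v : V) :
    T (charProjector ρ χ v) = charProjector σ χ (T v) := by
  simp_rw [charProjector_apply, map_sum, LinearMap.map_smul_of_tower, hT]

end

theorem exists_charEigenspace_eq_top [Nontrivial V] {ρ : Representation k N V}
    (h : ∀ n, ∃ c : k, ∀ v, ρ n v = c • v) : ∃ χ : N →* kˣ, charEigenspace ρ χ = ⊤ := by
  choose c hc using h
  obtain ⟨v, hv⟩ := exists_ne (0 : V)
  let χ : N →* k :=
    { toFun := c
      map_one' := smul_left_injective k hv <| by simp [← hc]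
      map_mul' := fun a b => smul_left_injective k hv <| by simp [← hc, mul_smul] }
  exact ⟨χ.toHomUnits, Submodule.eq_top_iff'.2 fun v n => hc n v⟩

theorem exists_charEigenspace_ne_bot_of_commute [Finite N] [IsAlgClosed k] [FiniteDimensional k V]
    [Nontrivial V] {ρ : Representation k N V} (h : ∀ a b, Commute (ρ a) (ρ b)) :
    ∃ χ : N →* kˣ, charEigenspace ρ χ ≠ ⊥ := by
  obtain ⟨U, -, hU⟩ := exists_isIrreducible_toRepresentation_of_ne_bot
    (U := (⊤ : Subrepresentation ρ)) fun h => top_ne_bot (congrArg Subrepresentation.toSubmodule h)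
  have := nontrivial_of_isIrreducible U.toRepresentation
  obtain ⟨χ, hχ⟩ := exists_charEigenspace_eq_top fun a =>
    exists_apply_eq_smul_of_isIrreducible (ρ := U.toRepresentation)
      ⟨U.toRepresentation a, fun b => LinearMap.ext fun u => Subtype.ext <|
        LinearMap.congr_fun (h a b) u⟩
  obtain ⟨u, hu⟩ := exists_ne (0 : U.toSubmodule)
  refine ⟨χ, Submodule.ne_bot_iff _ |>.2 ⟨u, fun n => ?_, by simpa using hu⟩⟩
  have hu' : u ∈ charEigenspace U.toRepresentation χ := hχ ▸ Submodule.mem_top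
  exact congrArg Subtype.val (hu' n)

variable {σ : Representation k G W} (i : N →* G) {α : G →* MulAut N}
  (hα : ∀ g n, i (α g n) = g * i n * g⁻¹) {χ θ : N →* kˣ}

include hα in
theorem apply_mem_charEigenspace_conj {w : W} (hw : w ∈ charEigenspace (σ.comp i) χ) (g : G) :
    σ g w ∈ charEigenspace (σ.comp i) (χ.comp (α g⁻¹).toMonoidHom) := by
  intro n
  have h : i n * g = g * i (α g⁻¹ n) := by rw [hα]; group
  rw [MonoidHom.comp_apply, ← Module.End.mul_apply, ← map_mul, h, map_mul, Module.End.mul_apply]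
  exact (congrArg (σ g) (hw _)).trans (LinearMap.map_smul_of_tower (σ g) _ _)

include hα in
theorem exists_eq_conj_of_mem_charEigenspace [Finite N] [CharZero k] [σ.IsIrreducible] {v w : W}
    (hv : v ∈ charEigenspace (σ.comp i) χ) (hv₀ : v ≠ 0)
    (hw : w ∈ charEigenspace (σ.comp i) θ) (hw₀ : w ≠ 0) :
    ∃ g : G, θ = χ.comp (α g).toMonoidHom := by
  cases nonempty_fintype N
  let U : Subrepresentation σ :=
    { toSubmodule := ⨅ g, LinearMap.ker (charProjector (σ.comp i) θ ∘ₗ σ g)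
      apply_mem_toSubmodule := fun g x hx => by
        simp only [Submodule.mem_iInf, LinearMap.mem_ker, LinearMap.comp_apply] at hx ⊢
        exact fun g' => by simpa using hx (g' * g) }
  by_cases hvU : v ∈ U.toSubmodule
  · have h₁ := (Submodule.mem_iInf _).1 (mem_of_mem_of_isIrreducible U hvU hv₀ w) 1
    rw [LinearMap.mem_ker, LinearMap.comp_apply, map_one, Module.End.one_apply,
      charProjector_apply_of_mem hw, ← Nat.cast_smul_eq_nsmul k] at h₁
    exact absurd h₁ (smul_ne_zero (Nat.cast_ne_zero.2 Fintype.card_ne_zero) hw₀)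
  · simp only [U, Submodule.mem_iInf, LinearMap.mem_ker, LinearMap.comp_apply, not_forall] at hvU
    obtain ⟨g, hg⟩ := hvU
    refine ⟨g⁻¹, ?_⟩
    contrapose! hg
    exact charProjector_apply_eq_zero (apply_mem_charEigenspace_conj i hα hv g) hg.symm

end Eigencharacters

section Induction

open Representation

variable {k L H V W : Type*} [Field k] [Group L] [Group H] [AddCommGroup V] [Module k V]
  [AddCommGroup W] [Module k W] {φ : L →* H} {τ : Representation k L V}
  {σ : Representation k H W}

variable (φ τ) in
/-- The generator `⟦h ⊗ v⟧` of the induced representation: Mathlib's `IndV.mk`, which is an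
abbreviation, as a definition that `simp` and `rw` do not unfold. -/
def indMk (h : H) : V →ₗ[k] IndV φ τ :=
  IndV.mk φ τ h

theorem ind_indMk (g h : H) (v : V) : ind φ τ g (indMk φ τ h v) = indMk φ τ (h * g⁻¹) v :=
  ind_mk φ τ g h v

theorem indMk_map_mul (l : L) (h : H) (v : V) :
    indMk φ τ (φ l * h) (τ l v) = indMk φ τ h v := by
  have := Coinvariants.mk_self_apply
    (Representation.tprod ((leftRegular k H).comp φ) τ) l (MonoidAlgebra.single h 1 ⊗ₜ[k] v)
  simpa [indMk] using this

theorem indV_hom_ext {f g : IndV φ τ →ₗ[k] W}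
    (hfg : ∀ h v, f (indMk φ τ h v) = g (indMk φ τ h v)) : f = g :=
  IndV.hom_ext φ τ fun h => LinearMap.ext (hfg h)

/-- The linear map out of an induced representation given on the generators `indMk φ τ h v` by a
family `F h v` compatible with the relations. -/
def indDesc (F : H → V →ₗ[k] W) (hF : ∀ l h v, F (φ l * h) (τ l v) = F h v) :
    IndV φ τ →ₗ[k] W :=
  Coinvariants.lift _
    (TensorProduct.lift (Finsupp.lift _ _ _ F ∘ₗ (MonoidAlgebra.coeffLinearEquiv k).toLinearMap))
    fun l => by
      ext h v
      simpa using hF l h v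

theorem indDesc_indMk (F : H → V →ₗ[k] W) (hF : ∀ l h v, F (φ l * h) (τ l v) = F h v) (h : H)
    (v : V) : indDesc F hF (indMk φ τ h v) = F h v := by
  simp [indDesc, indMk]

theorem ind_map_indMk_one (l : L) (v : V) :
    ind φ τ (φ l) (indMk φ τ 1 v) = indMk φ τ 1 (τ l v) := by
  rw [ind_indMk, ← indMk_map_mul l, one_mul, mul_inv_cancel]

theorem ind_map_indMk_of_mul_eq {l l' : L} {c : H} (h : φ l' * c = c * φ l) (v : V) :
    ind φ τ (φ l) (indMk φ τ c v) = indMk φ τ c (τ l' v) := by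
  rw [ind_indMk, ← indMk_map_mul l', ← mul_assoc, h, mul_inv_cancel_right]

theorem apply_inv_map_mul (f : IntertwiningMap τ (σ.comp φ)) (l : L) (h : H) (v : V) :
    σ (φ l * h)⁻¹ (f (τ l v)) = σ h⁻¹ (f v) := by
  have hf : f (τ l v) = σ (φ l) (f v) := IntertwiningMap.isIntertwining τ (σ.comp φ) f l v
  rw [hf, ← Module.End.mul_apply, ← map_mul, mul_inv_rev, inv_mul_cancel_right]

/-- Frobenius reciprocity: the extension of a map of `L`-representations `τ → σ` to the induced
representation. -/
def indLift (f : IntertwiningMap τ (σ.comp φ)) : IntertwiningMap (ind φ τ) σ where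
  toLinearMap := indDesc (fun h => σ h⁻¹ ∘ₗ f.toLinearMap) (apply_inv_map_mul f)
  isIntertwining' h := by
    refine indV_hom_ext fun g v => ?_
    rw [LinearMap.comp_apply, LinearMap.comp_apply, ind_indMk, indDesc_indMk, indDesc_indMk,
      mul_inv_rev, inv_inv, map_mul]
    rfl

theorem indLift_indMk (f : IntertwiningMap τ (σ.comp φ)) (h : H) (v : V) :
    indLift f (indMk φ τ h v) = σ h⁻¹ (f v) :=
  indDesc_indMk _ (apply_inv_map_mul f) h v

theorem mem_of_indMk_one_mem {U : Subrepresentation (ind φ τ)}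
    (hU : ∀ v, indMk φ τ 1 v ∈ U.toSubmodule) (x : IndV φ τ) : x ∈ U.toSubmodule := by
  have hmk : U.toSubmodule.mkQ = 0 := by
    refine indV_hom_ext fun h v => ?_
    have := U.apply_mem_toSubmodule h⁻¹ (hU v)
    rw [ind_indMk, inv_inv, one_mul] at this
    simpa using this
  simpa using LinearMap.congr_fun hmk x

variable (φ τ) in
open Classical in
/-- Evaluation at the identity `Ind τ → τ`, when the elements of the induced representation are seen
as `L`-equivariant functions on `H`; `x` corresponds to the function `h ↦ indEval φ τ (h x)`. -/
def indEval [Fintype L] : IndV φ τ →ₗ[k] V :=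
  indDesc (fun h => ∑ m, if φ m * h = 1 then τ m else 0) fun l h v => by
    rw [← Equiv.sum_comp (Equiv.mulRight l) fun m => if φ m * h = 1 then τ m else 0]
    simp only [Equiv.coe_mulRight, map_mul, mul_assoc, LinearMap.sum_apply]
    exact Finset.sum_congr rfl fun m _ => by split_ifs <;> rfl

variable [Fintype L]

open Classical in
theorem indEval_indMk (h : H) (v : V) :
    indEval φ τ (indMk φ τ h v) = ∑ m, if φ m * h = 1 then τ m v else 0 := by
  rw [indEval, indDesc_indMk, LinearMap.sum_apply]
  exact Finset.sum_congr rfl fun m _ => by split_ifs <;> rfl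

theorem indEval_indMk_one (hφ : Function.Injective φ) (v : V) :
    indEval φ τ (indMk φ τ 1 v) = v := by
  classical
  rw [indEval_indMk]
  simp [map_eq_one_iff φ hφ]

theorem indEval_indMk_of_notMem {h : H} (hh : h ∉ φ.range) (v : V) :
    indEval φ τ (indMk φ τ h v) = 0 := by
  classical
  rw [indEval_indMk]
  refine Finset.sum_eq_zero fun m _ => if_neg fun hm => hh ⟨m⁻¹, ?_⟩
  rw [map_inv, inv_eq_of_mul_eq_one_right hm]

theorem indEval_ind_map (m : L) (x : IndV φ τ) :
    indEval φ τ (ind φ τ (φ m) x) = τ m (indEval φ τ x) := by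
  classical
  suffices indEval φ τ ∘ₗ ind φ τ (φ m) = τ m ∘ₗ indEval φ τ from LinearMap.congr_fun this x
  refine indV_hom_ext fun h v => ?_
  rw [LinearMap.comp_apply, LinearMap.comp_apply, ind_indMk, indEval_indMk, indEval_indMk, map_sum,
    ← Equiv.sum_comp (Equiv.mulLeft m)]
  refine Finset.sum_congr rfl fun l _ => ?_
  have h_cond : φ (m * l) * (h * (φ m)⁻¹) = 1 ↔ φ l * h = 1 := by
    rw [map_mul, ← mul_assoc, mul_inv_eq_one, mul_assoc, mul_eq_left]
  simp only [Equiv.coe_mulLeft, h_cond, map_mul τ, Module.End.mul_apply, apply_ite (τ m), map_zero]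

theorem indEval_ind_of_mul_eq {l : L} {g h : H} (hg : φ l * g = g * h) (x : IndV φ τ) :
    indEval φ τ (ind φ τ g (ind φ τ h x)) = τ l (indEval φ τ (ind φ τ g x)) := by
  rw [← Module.End.mul_apply, ← map_mul, ← hg, map_mul, Module.End.mul_apply, indEval_ind_map]

theorem sum_indMk_indEval [Fintype H] (x : IndV φ τ) :
    ∑ h, indMk φ τ h (indEval φ τ (ind φ τ h x)) = Fintype.card L • x := by
  classical
  suffices ∑ h, indMk φ τ h ∘ₗ indEval φ τ ∘ₗ ind φ τ h = Fintype.card L • LinearMap.id by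
    simpa using LinearMap.congr_fun this x
  refine indV_hom_ext fun g v => ?_
  rw [LinearMap.sum_apply, LinearMap.smul_apply, LinearMap.id_apply]
  have h_terms : ∀ m, ∑ h, indMk φ τ h (if φ m * (g * h⁻¹) = 1 then τ m v else 0) =
      indMk φ τ g v := fun m => by
    simp only [apply_ite (indMk φ τ _), ← mul_assoc, mul_inv_eq_one, map_zero,
      Finset.sum_ite_eq, Finset.mem_univ, if_true, indMk_map_mul]
  calc ∑ h, (indMk φ τ h ∘ₗ indEval φ τ ∘ₗ ind φ τ h) (indMk φ τ g v)
      = ∑ h, ∑ m, indMk φ τ h (if φ m * (g * h⁻¹) = 1 then τ m v else 0) :=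
        Finset.sum_congr rfl fun h _ => by
          rw [LinearMap.comp_apply, LinearMap.comp_apply, ind_indMk, indEval_indMk, map_sum]
    _ = Fintype.card L • indMk φ τ g v := by
        rw [Finset.sum_comm]
        simp only [h_terms, Finset.sum_const, Finset.card_univ]

variable [Finite H] [CharZero k]

theorem eq_of_indEval_ind_eq {x y : IndV φ τ}
    (h : ∀ g, indEval φ τ (ind φ τ g x) = indEval φ τ (ind φ τ g y)) : x = y := by
  cases nonempty_fintype H
  have h_smul : Fintype.card L • x = Fintype.card L • y := by
    rw [← sum_indMk_indEval, ← sum_indMk_indEval]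
    simp only [h]
  simp only [← Nat.cast_smul_eq_nsmul k] at h_smul
  exact smul_right_injective _ (Nat.cast_ne_zero.2 Fintype.card_ne_zero) h_smul

theorem exists_indEval_ind_ne_zero {x : IndV φ τ} (hx : x ≠ 0) :
    ∃ g, indEval φ τ (ind φ τ g x) ≠ 0 := by
  contrapose! hx
  exact eq_of_indEval_ind_eq fun g => by rw [hx, map_zero, map_zero]

theorem eq_indMk_one_indEval (hφ : Function.Injective φ) {x : IndV φ τ}
    (hx : ∀ g ∉ φ.range, indEval φ τ (ind φ τ g x) = 0) :
    x = indMk φ τ 1 (indEval φ τ x) := by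
  refine eq_of_indEval_ind_eq fun g => ?_
  by_cases hg : g ∈ φ.range
  · obtain ⟨m, rfl⟩ := hg
    rw [indEval_ind_map, indEval_ind_map, indEval_indMk_one hφ]
  · rw [hx g hg, ind_indMk, one_mul, indEval_indMk_of_notMem (mt inv_mem_iff.1 hg)]

end Induction

section InducedFromCharacter

open Representation

variable {k N L H V W : Type*} [Field k] [Group N] [Group L] [Group H] [AddCommGroup V]
  [Module k V] [AddCommGroup W] [Module k W] {φ : L →* H} {τ : Representation k L V}
  {σ : Representation k H W}

theorem exists_rightInverse_of_surjective [IsSemisimpleRepresentation τ]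
    {σ : Representation k L W} (f : IntertwiningMap τ σ) (hf : Function.Surjective f) :
    ∃ s : IntertwiningMap σ τ, ∀ w, f (s w) = w := by
  have := isSemisimpleRepresentation_iff_isSemisimpleModule_asModule τ |>.1 inferInstance
  obtain ⟨s, hs⟩ := IsSemisimpleModule.lifting_property
    (IntertwiningMap.equivLinearMapAsModule τ σ f) hf LinearMap.id
  exact ⟨(IntertwiningMap.equivLinearMapAsModule σ τ).symm s, fun w => LinearMap.congr_fun hs w⟩

theorem indLift_ne_zero {f : IntertwiningMap τ (σ.comp φ)} (hf : f ≠ 0) : indLift f ≠ 0 :=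
  fun h => hf <| DFunLike.ext _ _ fun v => by
    have := indLift_indMk f 1 v
    rw [h, inv_one, map_one] at this
    exact this.symm

theorem nonempty_equiv_of_intertwiningMap_ne_zero [(ind φ τ).IsIrreducible] [σ.IsIrreducible]
    {f : IntertwiningMap τ (σ.comp φ)} (hf : f ≠ 0) : Nonempty ((ind φ τ).Equiv σ) :=
  ⟨(indLift f).ofBijective <|
    (IsIrreducible.bijective_or_eq_zero (indLift f)).resolve_right (indLift_ne_zero hf)⟩

theorem mem_range_of_isIrreducible_ind [Finite L] [Finite H] [IsAlgClosed k]
    [(ind φ τ).IsIrreducible] [Nontrivial V] (hφ : Function.Injective φ) {c : H}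
    (hc : ∀ l, ∃ l', φ l' * c = c * φ l ∧ τ l' = τ l) : c ∈ φ.range := by
  cases nonempty_fintype L
  obtain ⟨v, hv⟩ := exists_ne (0 : V)
  let f : IntertwiningMap τ ((ind φ τ).comp φ) :=
    { toLinearMap := indMk φ τ c
      isIntertwining' := fun l => by
        obtain ⟨l', h_mul, h_eq⟩ := hc l
        rw [← h_eq]
        exact LinearMap.ext fun v => (ind_map_indMk_of_mul_eq h_mul v).symm }
  obtain ⟨z, hz⟩ := exists_apply_eq_smul_of_isIrreducible (indLift f)
  have h_scalar : indMk φ τ c v = z • indMk φ τ 1 v := by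
    rw [← hz, indLift_indMk, inv_one, map_one]
    rfl
  by_contra hcr
  have hz₀ : z • v = 0 := by
    rw [← indEval_indMk_one (τ := τ) hφ v, ← map_smul, ← h_scalar,
      indEval_indMk_of_notMem hcr]
  have h_one : indMk φ τ 1 v = 0 := by
    have := ind_indMk (φ := φ) (τ := τ) c c v
    rwa [h_scalar, ← map_smul, hz₀, map_zero, map_zero, mul_inv_cancel, eq_comm] at this
  exact hv (by rw [← indEval_indMk_one (τ := τ) hφ v, h_one, map_zero])

variable [CharZero k] [Finite H]

theorem isIrreducible_ind_of_indEval_eq_zero [Finite N] [Fintype L] [τ.IsIrreducible]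
    (hφ : Function.Injective φ) (i : N →* L) {χ : N →* kˣ} {v₀ : V}
    (hv₀ : v₀ ∈ charEigenspace (τ.comp i) χ) (hv₀_ne : v₀ ≠ 0)
    (h_supp : ∀ z ∈ charEigenspace ((ind φ τ).comp (φ.comp i)) χ, ∀ g ∉ φ.range,
      indEval φ τ (ind φ τ g z) = 0) :
    (ind φ τ).IsIrreducible := by
  cases nonempty_fintype N
  have : Nontrivial (IndV φ τ) :=
    nontrivial_of_ne (indMk φ τ 1 v₀) 0 fun h => hv₀_ne <| by
      rw [← indEval_indMk_one (τ := τ) hφ v₀, h, map_zero]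
  refine isIrreducible_of_forall_mem fun U x hx hx₀ => mem_of_indMk_one_mem ?_
  let evalU : Subrepresentation τ :=
    { toSubmodule := U.toSubmodule.map (indEval φ τ)
      apply_mem_toSubmodule := by
        rintro l _ ⟨y, hy, rfl⟩
        exact ⟨ind φ τ (φ l) y, U.apply_mem_toSubmodule _ hy, indEval_ind_map l y⟩ }
  let fiberU : Subrepresentation τ :=
    { toSubmodule := U.toSubmodule.comap (indMk φ τ 1)
      apply_mem_toSubmodule := fun l v hv => by
        rw [Submodule.mem_comap, ← ind_map_indMk_one]
        exact U.apply_mem_toSubmodule _ hv }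
  obtain ⟨g, hg⟩ := exists_indEval_ind_ne_zero hx₀
  obtain ⟨y, hyU, hy⟩ : ∃ y ∈ U.toSubmodule, indEval φ τ y = v₀ :=
    mem_of_mem_of_isIrreducible evalU ⟨_, U.apply_mem_toSubmodule g hx, rfl⟩ hg v₀
  let z := charProjector ((ind φ τ).comp (φ.comp i)) χ y
  have hzU : z ∈ U.toSubmodule := by
    simp only [z, charProjector_apply]
    exact Submodule.sum_mem _ fun n _ =>
      Submodule.smul_mem _ _ (U.apply_mem_toSubmodule _ hyU)
  have hz_eval : indEval φ τ z = Fintype.card N • v₀ := by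
    rw [map_charProjector (σ := τ.comp i) (indEval φ τ) fun n v => indEval_ind_map (i n) v, hy,
      charProjector_apply_of_mem hv₀]
  have hz : z = indMk φ τ 1 (Fintype.card N • v₀) := by
    rw [← hz_eval]
    exact eq_indMk_one_indEval hφ (h_supp z (charProjector_mem_charEigenspace _))
  have hN : Fintype.card N • v₀ ≠ 0 := by
    rw [← Nat.cast_smul_eq_nsmul k]
    exact smul_ne_zero (Nat.cast_ne_zero.2 Fintype.card_ne_zero) hv₀_ne
  exact mem_of_mem_of_isIrreducible fiberU (by rwa [Submodule.mem_comap, ← hz]) hN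

theorem charEigenspace_ne_bot_of_intertwiningMap_ind [Finite L] {θ : L →* kˣ}
    (hτ : charEigenspace τ θ = ⊤) {T : IntertwiningMap σ (ind φ τ)} (hT : T ≠ 0) :
    charEigenspace (σ.comp φ) θ ≠ ⊥ := by
  cases nonempty_fintype L
  obtain ⟨w, hw⟩ : ∃ w, T w ≠ 0 := by
    contrapose! hT
    exact DFunLike.ext _ _ hT
  obtain ⟨g, hg⟩ := exists_indEval_ind_ne_zero hw
  have h_apply : ∀ h v, T (σ h v) = ind φ τ h (T v) := IntertwiningMap.isIntertwining _ _ T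
  have h_proj : indEval φ τ (T (charProjector (σ.comp φ) θ (σ g w))) =
      Fintype.card L • indEval φ τ (ind φ τ g (T w)) := by
    rw [← h_apply, ← charProjector_apply_of_mem (ρ := τ) (hτ ▸ Submodule.mem_top)]
    exact map_charProjector (σ := τ) (indEval φ τ ∘ₗ T.toLinearMap)
      (fun l v => (congrArg (indEval φ τ) (h_apply (φ l) v)).trans (indEval_ind_map l _)) _
  refine (Submodule.ne_bot_iff _).2 ⟨_, charProjector_mem_charEigenspace (σ g w), fun h => ?_⟩
  rw [h, map_zero, map_zero, ← Nat.cast_smul_eq_nsmul k] at h_proj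
  exact smul_ne_zero (Nat.cast_ne_zero.2 Fintype.card_ne_zero) hg h_proj.symm

theorem exists_injective_intertwiningMap_ind [σ.IsIrreducible]
    {f : IntertwiningMap τ (σ.comp φ)} (hf : f ≠ 0) :
    ∃ T : IntertwiningMap σ (ind φ τ), Function.Injective T := by
  have h_surj : Function.Surjective (indLift f) :=
    (IsIrreducible.surjective_or_eq_zero (indLift f)).resolve_right (indLift_ne_zero hf)
  obtain ⟨s, hs⟩ := exists_rightInverse_of_surjective (indLift f) h_surj
  exact ⟨s, Function.LeftInverse.injective hs⟩

end InducedFromCharacter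

section CharRep

open Representation

variable {L H W : Type*} [Group L] [Group H] [AddCommGroup W] [Module ℂ W] {φ : L →* H}
  {θ : L →* ℂˣ} {σ : Representation ℂ H W}

theorem charEigenspace_charRep : charEigenspace (charRep θ) θ = ⊤ :=
  Submodule.eq_top_iff'.2 fun _ _ => rfl

instance isIrreducible_charRep : (charRep θ).IsIrreducible :=
  isIrreducible_of_forall_mem fun U v hv hv₀ w => by
    simpa [hv₀] using U.toSubmodule.smul_mem (w / v) hv

theorem exists_injective_intertwiningMap_ind_charRep_iff [Finite L] [Finite H] [σ.IsIrreducible] :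
    (∃ T : σ.IntertwiningMap (ind φ (charRep θ)), Function.Injective T) ↔
      charEigenspace (σ.comp φ) θ ≠ ⊥ := by
  constructor
  · rintro ⟨T, hT⟩
    refine charEigenspace_ne_bot_of_intertwiningMap_ind charEigenspace_charRep (T := T) ?_
    rintro rfl
    obtain ⟨w, hw⟩ := @exists_ne _ (nontrivial_of_isIrreducible σ) (0 : W)
    exact hw (hT rfl)
  · intro h
    obtain ⟨w, hw, hw₀⟩ := (Submodule.ne_bot_iff _).1 h
    let f : IntertwiningMap (charRep θ) (σ.comp φ) :=
      { toLinearMap := LinearMap.toSpanSingleton ℂ W w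
        isIntertwining' := fun l => LinearMap.ext_ring <| by
          have := hw l
          simp_all [charRep, Units.smul_def] }
    refine exists_injective_intertwiningMap_ind (f := f) fun hf => hw₀ ?_
    have := DFunLike.congr_fun hf (1 : ℂ)
    exact (one_smul ℂ w).symm.trans this

end CharRep

section IrreduciblesOver

open Representation

variable {G : Type*} [Group G] {K : Subgroup G} {χ : K →* ℂˣ}

section

variable {H V : Type*} [Group H] {f : H →* G} [AddCommGroup V] [Module ℂ V]
  {σ : Representation ℂ H V}

variable (χ f σ) in
/-- The space of vectors in a representation of `H` on which the elements lying over `K` act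
through `χ`; an irreducible representation belongs to `Irr(H | χ)` when it is not zero. -/
def overEigenspace : Submodule ℂ V :=
  charEigenspace (σ.comp (K.comap f).subtype) (χ.comp (f.subgroupComap K))

theorem mem_overEigenspace {w : V} :
    w ∈ overEigenspace χ f σ ↔ ∀ (h : H) (hk : f h ∈ K), σ h w = χ ⟨f h, hk⟩ • w :=
  ⟨fun hw h hk => hw ⟨h, hk⟩, fun hw h => hw h h.2⟩

theorem apply_mem_overEigenspace [K.Normal] {c : H} (hc : f c ∈ inertiaGroup χ) {w : V}
    (hw : w ∈ overEigenspace χ f σ) : σ c w ∈ overEigenspace χ f σ := by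
  have h_fix : (χ.comp (f.subgroupComap K)).comp
      (MulAut.conjNormal c⁻¹ : MulAut (K.comap f)).toMonoidHom = χ.comp (f.subgroupComap K) :=
    MonoidHom.ext fun h => by
      have hc' : (f c)⁻¹ ∈ inertiaGroup χ := inv_mem hc
      refine (congrArg χ (Subtype.ext ?_)).trans (hc' _)
      change f (c⁻¹ * h * c⁻¹⁻¹) = (f c)⁻¹ * f h * (f c)⁻¹⁻¹
      simp only [map_mul, map_inv]
  have h_conj := apply_mem_charEigenspace_conj (K.comap f).subtype (α := MulAut.conjNormal)
    (fun _ _ => rfl) hw c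
  rwa [h_fix] at h_conj

instance isIrreducible_rep (δ : IrrOver χ f) : δ.rep.ρ.IsIrreducible :=
  δ.irreducible

theorem IrrOver.overEigenspace_ne_bot [Finite H] (δ : IrrOver χ f) :
    overEigenspace χ f δ.rep.ρ ≠ ⊥ :=
  exists_injective_intertwiningMap_ind_charRep_iff.1 δ.constituent

theorem exists_irrOver_equiv [Finite H] [σ.IsIrreducible] (hσ : overEigenspace χ f σ ≠ ⊥) :
    ∃ δ : IrrOver χ f, Nonempty (δ.rep.ρ.Equiv σ) := by
  have := finiteDimensional_of_isIrreducible σ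
  let b : V ≃ₗ[ℂ] (Fin (Module.finrank ℂ V) → ℂ) := (Module.finBasis ℂ V).equivFun
  let τ : Representation ℂ H (Fin (Module.finrank ℂ V) → ℂ) :=
    (b.conjRingEquiv : _ →* _).comp σ
  have hb : ∀ h v, b (σ h v) = τ h (b v) := fun h v => by simp [τ]
  have : τ.IsIrreducible := isIrreducible_of_equivariant id b hb
  obtain ⟨w, hw, hw₀⟩ := (Submodule.ne_bot_iff _).1 hσ
  have hτ : overEigenspace χ f τ ≠ ⊥ :=
    (Submodule.ne_bot_iff _).2 ⟨b w, mem_overEigenspace.2 fun h hk => by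
      rw [← hb, mem_overEigenspace.1 hw h hk]
      exact LinearMap.map_smul_of_tower b.toLinearMap _ _, by simpa using hw₀⟩
  exact ⟨⟨Rep.of τ, ‹_›, exists_injective_intertwiningMap_ind_charRep_iff.2 hτ⟩,
    ⟨(Representation.Equiv.mk b fun h => LinearMap.ext (hb h)).symm⟩⟩

end

variable [K.Normal]

theorem le_inertiaGroup (χ : K →* ℂˣ) : K ≤ inertiaGroup χ := by
  intro k hk n
  have h_conj : MulAut.conjNormal k n = (⟨k, hk⟩ : K) * n * ⟨k, hk⟩⁻¹ := Subtype.ext rfl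
  rw [h_conj, map_mul, map_mul, map_inv, mul_comm, inv_mul_cancel_left]

theorem inclG_injective (M : Subgroup (inertiaGroup χ)) : Function.Injective (inclG M) :=
  (Subgroup.subtype_injective _).comp (Subgroup.subtype_injective _)

variable {N M M' : Subgroup (inertiaGroup χ)}

section

variable [Finite G]

theorem IrrOver.overEigenspace_eq_top (ρ : IrrOver χ (inclG M)) :
    overEigenspace χ (inclG M) ρ.rep.ρ = ⊤ := by
  let U : Subrepresentation ρ.rep.ρ :=
    { toSubmodule := overEigenspace χ (inclG M) ρ.rep.ρ
      apply_mem_toSubmodule := fun m _ hv => apply_mem_overEigenspace m.1.2 hv }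
  obtain ⟨w, hw, hw₀⟩ := (Submodule.ne_bot_iff _).1 ρ.overEigenspace_ne_bot
  exact Submodule.eq_top_iff'.2 (mem_of_mem_of_isIrreducible U hw hw₀)

theorem IrrOver.apply_eq_smul (ρ : IrrOver χ (inclG M)) (m : M) (hm : inclG M m ∈ K)
    (v : ρ.rep) : ρ.rep.ρ m v = χ ⟨inclG M m, hm⟩ • v :=
  mem_overEigenspace.1 (ρ.overEigenspace_eq_top ▸ Submodule.mem_top) m hm

theorem IrrOver.indMk_one_mem_overEigenspace (hM : K.subgroupOf (inertiaGroup χ) ≤ M)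
    (ρ : IrrOver χ (inclG M)) (v : ρ.rep) :
    indMk (inclG M) ρ.rep.ρ 1 v ∈ overEigenspace χ (.id G) (ind (inclG M) ρ.rep.ρ) := by
  refine mem_overEigenspace.2 fun k hk => ?_
  let m : M := ⟨⟨k, le_inertiaGroup χ hk⟩, hM hk⟩
  exact (ind_map_indMk_one m v).trans <|
    (congrArg _ (ρ.apply_eq_smul m hk v)).trans (LinearMap.map_smul_of_tower _ _ _)

theorem IrrOver.mem_inertiaGroup_of_indEval_ne_zero [Fintype M]
    (hM : K.subgroupOf (inertiaGroup χ) ≤ M) (ρ : IrrOver χ (inclG M))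
    {x : IndV (inclG M) ρ.rep.ρ}
    (hx : x ∈ overEigenspace χ (.id G) (ind (inclG M) ρ.rep.ρ)) {g : G}
    (hg : indEval (inclG M) ρ.rep.ρ (ind (inclG M) ρ.rep.ρ g x) ≠ 0) : g ∈ inertiaGroup χ := by
  intro k
  have hgk : g * k * g⁻¹ ∈ K := ‹K.Normal›.conj_mem _ k.2 g
  let m : M := ⟨⟨g * k * g⁻¹, le_inertiaGroup χ hgk⟩, hM hgk⟩
  have h_mul : inclG M m * g = g * k := inv_mul_cancel_right _ _
  have h := indEval_ind_of_mul_eq h_mul x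
  rw [ρ.apply_eq_smul m hgk, mem_overEigenspace.1 hx k k.2] at h
  simp only [Units.smul_def, map_smul] at h
  exact Units.ext (smul_left_injective ℂ hg h.symm)

end

end IrreduciblesOver

section CliffordCorrespondence

open Representation
open scoped commutatorElement

variable {G : Type*} [Group G] {K : Subgroup G} [K.Normal] {χ : K →* ℂˣ}

/-- The subgroup `N` contains `K` and all its commutators lie in the kernel of `χ`: every
representation of `N` on which `K` acts through `χ` factors through an abelian quotient. -/
structure IsAbelianOver (χ : K →* ℂˣ) (N : Subgroup (inertiaGroup χ)) : Prop where
  le : K.subgroupOf (inertiaGroup χ) ≤ N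
  commutator : ∀ a ∈ N, ∀ b ∈ N, ∃ h : ((⁅a, b⁆ : inertiaGroup χ) : G) ∈ K, χ ⟨_, h⟩ = 1

/-- The linear character `χ₁` of `N` extends the linear character `χ` of `K`. -/
def Extends (χ : K →* ℂˣ) {N : Subgroup (inertiaGroup χ)} (χ₁ : N →* ℂˣ) : Prop :=
  ∀ (n : N) (h : inclG N n ∈ K), χ₁ n = χ ⟨inclG N n, h⟩

variable {N M M' : Subgroup (inertiaGroup χ)} [Finite G]

theorem IrrOver.exists_extends_charEigenspace_ne_bot (hN : IsAbelianOver χ N) (hNM : N ≤ M)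
    (ρ : IrrOver χ (inclG M)) :
    ∃ χ₁ : N →* ℂˣ, Extends χ χ₁ ∧
      charEigenspace (ρ.rep.ρ.comp (Subgroup.inclusion hNM)) χ₁ ≠ ⊥ := by
  have := finiteDimensional_of_isIrreducible ρ.rep.ρ
  have := nontrivial_of_isIrreducible ρ.rep.ρ
  have h_comm : ∀ a b : N, Commute (ρ.rep.ρ.comp (Subgroup.inclusion hNM) a)
      (ρ.rep.ρ.comp (Subgroup.inclusion hNM) b) := fun a b => by
    obtain ⟨hk, h_one⟩ := hN.commutator a a.2 b b.2
    have h_act : ρ.rep.ρ.comp (Subgroup.inclusion hNM) ⁅a, b⁆ = 1 := LinearMap.ext fun v =>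
      (ρ.apply_eq_smul (Subgroup.inclusion hNM ⁅a, b⁆) hk v).trans <|
        (congrArg (· • v) h_one).trans (one_smul _ v)
    have h_mul : a * b = ⁅a, b⁆ * (b * a) := by rw [commutatorElement_def]; group
    rw [commute_iff_eq, ← map_mul, ← map_mul, h_mul, map_mul, h_act, one_mul]
  obtain ⟨χ₁, hχ₁⟩ := exists_charEigenspace_ne_bot_of_commute h_comm
  obtain ⟨v, hv, hv₀⟩ := (Submodule.ne_bot_iff _).1 hχ₁
  refine ⟨χ₁, fun n hk => Units.ext (smul_left_injective ℂ hv₀ ?_), hχ₁⟩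
  exact (hv n).symm.trans (ρ.apply_eq_smul (Subgroup.inclusion hNM n) hk v)

theorem IrrOver.ind_isIrreducible [N.Normal] (hN : IsAbelianOver χ N) (hNM : N ≤ M)
    (hM : ∀ χ₁ : N →* ℂˣ, Extends χ χ₁ → inertiaGroup χ₁ ≤ M) (ρ : IrrOver χ (inclG M)) :
    (ρ.rep.ρ.ind (inclG M)).IsIrreducible := by
  cases nonempty_fintype M
  obtain ⟨χ₁, h_ext, hχ₁⟩ := ρ.exists_extends_charEigenspace_ne_bot hN hNM
  obtain ⟨v₀, hv₀, hv₀_ne⟩ := (Submodule.ne_bot_iff _).1 hχ₁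
  refine isIrreducible_ind_of_indEval_eq_zero (inclG_injective M) (Subgroup.inclusion hNM) hv₀
    hv₀_ne fun z hz g => not_imp_comm.1 fun h_ne => ?_
  have hz_over : z ∈ overEigenspace χ (.id G) (ind (inclG M) ρ.rep.ρ) :=
    mem_overEigenspace.2 fun k hk => by
      let n : N := ⟨⟨k, le_inertiaGroup χ hk⟩, hN.le hk⟩
      exact (hz n).trans (congrArg (· • z) (h_ext n hk))
  let c : inertiaGroup χ :=
    ⟨g, ρ.mem_inertiaGroup_of_indEval_ne_zero (hN.le.trans hNM) hz_over h_ne⟩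
  have h_conj : indEval (inclG M) ρ.rep.ρ (ind (inclG M) ρ.rep.ρ g z) ∈
      charEigenspace (ρ.rep.ρ.comp (Subgroup.inclusion hNM))
        (χ₁.comp (MulAut.conjNormal c⁻¹ : MulAut N).toMonoidHom) := fun n => by
    have h_mul : inclG M (Subgroup.inclusion hNM n) * g =
        g * inclG M (Subgroup.inclusion hNM (MulAut.conjNormal c⁻¹ n)) := by
      simp [c, mul_assoc]
    refine (indEval_ind_of_mul_eq h_mul z).symm.trans ?_
    refine (congrArg _ (congrArg _ (hz (MulAut.conjNormal c⁻¹ n)))).trans ?_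
    simp only [Units.smul_def, map_smul]
    rfl
  obtain ⟨m, hm⟩ := exists_eq_conj_of_mem_charEigenspace (Subgroup.inclusion hNM)
    (α := MulAut.conjNormal.comp M.subtype) (fun _ _ => Subtype.ext rfl) hv₀ hv₀_ne h_conj h_ne
  have hmc : (m : inertiaGroup χ) * c ∈ inertiaGroup χ₁ := fun n => by
    have := DFunLike.congr_fun hm (MulAut.conjNormal c n)
    simp only [map_inv, MonoidHom.comp_apply, MulEquiv.toMonoidHom_eq_coe, MonoidHom.coe_coe,
      MulAut.inv_apply_self] at this
    rw [map_mul, MulAut.mul_apply, this]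
    rfl
  exact ⟨⟨c, (M.mul_mem_cancel_left m.2).1 (hM χ₁ h_ext hmc)⟩, rfl⟩

theorem IrrOver.exists_equiv_ind
    (h_ind : ∀ ρ : IrrOver χ (inclG M), (ρ.rep.ρ.ind (inclG M)).IsIrreducible)
    (δ : IrrOver χ (.id G)) :
    ∃ ρ : IrrOver χ (inclG M), Nonempty (δ.rep.ρ.Equiv (ρ.rep.ρ.ind (inclG M))) := by
  have := finiteDimensional_of_isIrreducible δ.rep.ρ
  let U : Subrepresentation (δ.rep.ρ.comp (inclG M)) :=
    { toSubmodule := overEigenspace χ (.id G) δ.rep.ρ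
      apply_mem_toSubmodule := fun m v hv =>
        apply_mem_overEigenspace (f := .id G) (c := inclG M m) m.1.2 hv }
  obtain ⟨U', hU', _⟩ := exists_isIrreducible_toRepresentation_of_ne_bot (U := U)
    fun h => δ.overEigenspace_ne_bot (congrArg Subrepresentation.toSubmodule h)
  have := nontrivial_of_isIrreducible U'.toRepresentation
  obtain ⟨u, hu⟩ := exists_ne (0 : U'.toSubmodule)
  obtain ⟨ρ, ⟨e⟩⟩ := exists_irrOver_equiv (χ := χ) (f := inclG M) (σ := U'.toRepresentation) <|
    (Submodule.ne_bot_iff _).2 ⟨u, mem_overEigenspace.2 fun m hm =>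
      Subtype.ext (mem_overEigenspace.1 (hU' u.2) (inclG M m) hm), hu⟩
  have := h_ind ρ
  let f : IntertwiningMap ρ.rep.ρ (δ.rep.ρ.comp (inclG M)) :=
    { toLinearMap := U'.toSubmodule.subtype ∘ₗ e.toLinearMap
      isIntertwining' := fun m => LinearMap.ext fun v =>
        congrArg Subtype.val (IntertwiningMap.isIntertwining _ _ e.toIntertwiningMap m v) }
  have hf : f ≠ 0 := fun h => hu <| Subtype.ext <| by
    have h_zero := DFunLike.congr_fun h (e.symm u)
    exact (congrArg Subtype.val (e.apply_symm_apply u)).symm.trans h_zero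
  obtain ⟨E⟩ := nonempty_equiv_of_intertwiningMap_ne_zero hf
  exact ⟨ρ, ⟨E.symm⟩⟩

theorem IrrOver.exists_equiv_of_ind (hM : K.subgroupOf (inertiaGroup χ) ≤ M)
    (ρ : IrrOver χ (inclG M)) (h_ind : (ρ.rep.ρ.ind (inclG M)).IsIrreducible) :
    ∃ δ : IrrOver χ (.id G), Nonempty (δ.rep.ρ.Equiv (ρ.rep.ρ.ind (inclG M))) := by
  cases nonempty_fintype M
  have := nontrivial_of_isIrreducible ρ.rep.ρ
  obtain ⟨v, hv⟩ := exists_ne (0 : ρ.rep)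
  refine exists_irrOver_equiv <| (Submodule.ne_bot_iff _).2
    ⟨_, ρ.indMk_one_mem_overEigenspace hM v, fun h => hv ?_⟩
  rw [← indEval_indMk_one (τ := ρ.rep.ρ) (inclG_injective M) v, h, map_zero]

section

variable [M.Normal] {ρ₁ ρ₂ : IrrOver χ (inclG M)}

theorem IsConjRep.nonempty_equiv_ind (h₁ : (ρ₁.rep.ρ.ind (inclG M)).IsIrreducible)
    (h₂ : (ρ₂.rep.ρ.ind (inclG M)).IsIrreducible) (h : IsConjRep ρ₁.rep.ρ ρ₂.rep.ρ) :
    Nonempty ((ρ₁.rep.ρ.ind (inclG M)).Equiv (ρ₂.rep.ρ.ind (inclG M))) := by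
  cases nonempty_fintype M
  obtain ⟨c, T, hT⟩ := h
  have h_mul : ∀ m, inclG M (MulAut.conjNormal c m) * c = c * inclG M m := fun m => by simp
  let f : IntertwiningMap ρ₁.rep.ρ ((ind (inclG M) ρ₂.rep.ρ).comp (inclG M)) :=
    { toLinearMap := indMk (inclG M) ρ₂.rep.ρ c ∘ₗ T.toLinearMap
      isIntertwining' := fun m => LinearMap.ext fun v =>
        (congrArg _ (hT m v)).trans (ind_map_indMk_of_mul_eq (h_mul m) (T v)).symm }
  refine nonempty_equiv_of_intertwiningMap_ne_zero (f := f) fun hf => ?_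
  have := nontrivial_of_isIrreducible ρ₁.rep.ρ
  obtain ⟨v, hv⟩ := exists_ne (0 : ρ₁.rep)
  have h_one : indMk (inclG M) ρ₂.rep.ρ 1 (T v) = 0 := by
    rw [← mul_inv_cancel (c : G), ← ind_indMk]
    exact (congrArg _ (DFunLike.congr_fun hf v)).trans (map_zero _)
  refine hv ((LinearEquiv.map_eq_zero_iff T).1 ?_)
  rw [← indEval_indMk_one (τ := ρ₂.rep.ρ) (inclG_injective M) (T v), h_one, map_zero]

theorem IsConjRep.of_equiv_ind (hM : K.subgroupOf (inertiaGroup χ) ≤ M)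
    (e : (ρ₁.rep.ρ.ind (inclG M)).Equiv (ρ₂.rep.ρ.ind (inclG M))) :
    IsConjRep ρ₁.rep.ρ ρ₂.rep.ρ := by
  cases nonempty_fintype M
  have := nontrivial_of_isIrreducible ρ₁.rep.ρ
  obtain ⟨v, hv⟩ := exists_ne (0 : ρ₁.rep)
  have he : ∀ g x, e (ind (inclG M) ρ₁.rep.ρ g x) = ind (inclG M) ρ₂.rep.ρ g (e x) :=
    IntertwiningMap.isIntertwining _ _ e.toIntertwiningMap
  have hx_over : e (indMk (inclG M) ρ₁.rep.ρ 1 v) ∈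
      overEigenspace χ (.id G) (ind (inclG M) ρ₂.rep.ρ) := mem_overEigenspace.2 fun k hk => by
    rw [← he, mem_overEigenspace.1 (ρ₁.indMk_one_mem_overEigenspace hM v) k hk]
    exact LinearMap.map_smul_of_tower e.toLinearMap _ _
  have hx : e (indMk (inclG M) ρ₁.rep.ρ 1 v) ≠ 0 := fun h => hv <| by
    rw [← indEval_indMk_one (τ := ρ₁.rep.ρ) (inclG_injective M) v,
      e.toLinearEquiv.map_eq_zero_iff.1 h, map_zero]
  obtain ⟨g, hg⟩ := exists_indEval_ind_ne_zero hx
  let c : inertiaGroup χ := ⟨g, ρ₂.mem_inertiaGroup_of_indEval_ne_zero hM hx_over hg⟩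
  have h_mul : ∀ m, inclG M (MulAut.conjNormal c m) * g = g * inclG M m := fun m => by simp [c]
  let T : IntertwiningMap ρ₁.rep.ρ (ρ₂.rep.ρ.comp (MulAut.conjNormal c : MulAut M).toMonoidHom) :=
    { toLinearMap := indEval (inclG M) ρ₂.rep.ρ ∘ₗ ind (inclG M) ρ₂.rep.ρ g ∘ₗ e.toLinearMap ∘ₗ
        indMk (inclG M) ρ₁.rep.ρ 1
      isIntertwining' := fun m => LinearMap.ext fun v => by
        refine Eq.trans ?_ (indEval_ind_of_mul_eq (h_mul m) (e (indMk (inclG M) ρ₁.rep.ρ 1 v)))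
        rw [← he, ind_map_indMk_one]
        rfl }
  have : IsIrreducible (ρ₂.rep.ρ.comp (MulAut.conjNormal c : MulAut M).toMonoidHom) :=
    isIrreducible_of_equivariant (ρ := ρ₂.rep.ρ) (MulAut.conjNormal c : MulAut M).symm (.refl ℂ _)
      fun m w => by simp
  have hT : Function.Bijective T :=
    (IsIrreducible.bijective_or_eq_zero T).resolve_right fun h => hg (DFunLike.congr_fun h v)
  exact ⟨c, .ofBijective T.toLinearMap hT, IntertwiningMap.isIntertwining _ _ T⟩

end

end CliffordCorrespondence

section CliffordCorrespondence

open Representation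

variable {G : Type*} [Group G] {K : Subgroup G} [K.Normal] {χ : K →* ℂˣ}
  {N M M' : Subgroup (inertiaGroup χ)} [Finite G]

theorem inductionBijective_of_ind_isIrreducible [M.Normal]
    (hM : K.subgroupOf (inertiaGroup χ) ≤ M)
    (h_ind : ∀ ρ : IrrOver χ (inclG M), (ρ.rep.ρ.ind (inclG M)).IsIrreducible) :
    InductionBijective χ M := by
  choose δ hδ using fun ρ : IrrOver χ (inclG M) => ρ.exists_equiv_of_ind hM (h_ind ρ)
  have h_mk : ∀ ρ d, Quotient.mk (isoSetoid χ (.id G)) (δ ρ) = Quotient.mk _ d ↔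
      Nonempty (d.rep.ρ.Equiv (ρ.rep.ρ.ind (inclG M))) := fun ρ d => by
    obtain ⟨e⟩ := hδ ρ
    exact Quotient.eq.trans
      ⟨fun ⟨e'⟩ => ⟨e'.symm.trans e⟩, fun ⟨e'⟩ => ⟨e.trans e'.symm⟩⟩
  let Φ : Quotient (conjSetoid χ M) → Quotient (isoSetoid χ (.id G)) :=
    Quotient.lift (fun ρ => Quotient.mk _ (δ ρ)) fun ρ₁ ρ₂ h => by
      obtain ⟨e⟩ := IsConjRep.nonempty_equiv_ind (h_ind ρ₁) (h_ind ρ₂) h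
      obtain ⟨e₂⟩ := hδ ρ₂
      exact (h_mk _ _).2 ⟨e₂.trans e.symm⟩
  have hΦ : Function.Bijective Φ := by
    constructor
    · rintro ⟨ρ₁⟩ ⟨ρ₂⟩ h
      obtain ⟨e⟩ := (h_mk _ _).1 h
      obtain ⟨e₂⟩ := hδ ρ₂
      exact Quotient.sound (IsConjRep.of_equiv_ind hM (e.symm.trans e₂))
    · rintro ⟨d⟩
      obtain ⟨ρ, h⟩ := d.exists_equiv_ind h_ind
      exact ⟨Quotient.mk _ ρ, (h_mk ρ d).2 h⟩
  exact ⟨.ofBijective Φ hΦ, h_mk⟩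

theorem le_of_extends_of_ind_isIrreducible [M'.Normal] (hM' : M' ≤ M) {χ' : M →* ℂˣ}
    (hχ' : Extends χ χ')
    (h_ind : ∀ ρ : IrrOver χ (inclG M'), (ρ.rep.ρ.ind (inclG M')).IsIrreducible) : M ≤ M' := by
  intro c hc
  let θ : M' →* ℂˣ := χ'.comp (Subgroup.inclusion hM')
  have hθ : overEigenspace χ (inclG M') (charRep θ) ≠ ⊥ :=
    (Submodule.ne_bot_iff _).2 ⟨1, mem_overEigenspace.2 fun m hm =>
      congrArg (· • (1 : ℂ)) (hχ' (Subgroup.inclusion hM' m) hm), one_ne_zero⟩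
  have : (ind (inclG M') (charRep θ)).IsIrreducible :=
    h_ind ⟨Rep.of (charRep θ), isIrreducible_charRep,
      exists_injective_intertwiningMap_ind_charRep_iff.2 hθ⟩
  have h_range : (c : G) ∈ (inclG M').range := by
    refine mem_range_of_isIrreducible_ind (τ := charRep θ) (inclG_injective M') fun m =>
      ⟨MulAut.conjNormal c m, by simp, ?_⟩
    have h_conj : Subgroup.inclusion hM' (MulAut.conjNormal c m) =
        ⟨c, hc⟩ * Subgroup.inclusion hM' m * ⟨c, hc⟩⁻¹ := Subtype.ext rfl
    have h_fix : θ (MulAut.conjNormal c m) = θ m := by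
      rw [MonoidHom.comp_apply, h_conj, map_mul, map_mul, map_inv, mul_comm, inv_mul_cancel_left]
      rfl
    change (Algebra.lmul ℂ ℂ) (θ _ : ℂ) = (Algebra.lmul ℂ ℂ) (θ m : ℂ)
    rw [h_fix]
  obtain ⟨m, hm⟩ := h_range
  exact Subtype.ext hm ▸ m.2

theorem IrrOver.finrank_eq_one (hM : IsAbelianOver χ M) (ρ : IrrOver χ (inclG M)) :
    Module.finrank ℂ ρ.rep = 1 := by
  classical
  obtain ⟨χ₁, -, hχ₁⟩ := ρ.exists_extends_charEigenspace_ne_bot hM le_rfl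
  obtain ⟨v, hv, hv₀⟩ := (Submodule.ne_bot_iff _).1 hχ₁
  have := finiteDimensional_of_isIrreducible ρ.rep.ρ
  have := nontrivial_of_isIrreducible ρ.rep.ρ
  refine le_antisymm ?_ Module.finrank_pos
  refine finrank_le_card_of_apply_mem_span (ρ := ρ.rep.ρ) (s := {v}) hv₀ fun m => ?_
  rw [Finset.coe_singleton]
  exact Submodule.mem_span_singleton.2 ⟨_, (hv m).symm⟩

theorem IrrOver.finrank_eq_one_or_two (hN : IsAbelianOver χ N) (hNM : N ≤ M)
    {e : inertiaGroup χ} (he : e ∈ M) (hM : ∀ m ∈ M, m ∈ N ∨ e⁻¹ * m ∈ N)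
    (ρ : IrrOver χ (inclG M)) : Module.finrank ℂ ρ.rep = 1 ∨ Module.finrank ℂ ρ.rep = 2 := by
  classical
  obtain ⟨χ₁, -, hχ₁⟩ := ρ.exists_extends_charEigenspace_ne_bot hN hNM
  obtain ⟨v, hv, hv₀⟩ := (Submodule.ne_bot_iff _).1 hχ₁
  have := finiteDimensional_of_isIrreducible ρ.rep.ρ
  have := nontrivial_of_isIrreducible ρ.rep.ρ
  have h_pos : 0 < Module.finrank ℂ ρ.rep := Module.finrank_pos
  suffices Module.finrank ℂ ρ.rep ≤ 2 by lia
  refine (finrank_le_card_of_apply_mem_span (ρ := ρ.rep.ρ) (s := {v, ρ.rep.ρ ⟨e, he⟩ v}) hv₀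
    fun m => ?_).trans Finset.card_le_two
  rcases hM m m.2 with hm | hm
  · rw [show ρ.rep.ρ m v = _ from hv ⟨m, hm⟩]
    exact Submodule.smul_of_tower_mem _ _ (Submodule.subset_span (by simp))
  · have h_mul : m = ⟨e, he⟩ * Subgroup.inclusion hNM ⟨_, hm⟩ :=
      Subtype.ext (mul_inv_cancel_left _ _).symm
    rw [h_mul, map_mul, Module.End.mul_apply,
      show ρ.rep.ρ (Subgroup.inclusion hNM ⟨_, hm⟩) v = _ from hv ⟨_, hm⟩,
      LinearMap.map_smul_of_tower]
    exact Submodule.smul_of_tower_mem _ _ (Submodule.subset_span (by simp))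

end CliffordCorrespondence

section Stabilizers

open Representation
open scoped commutatorElement

theorem commutatorElement_mem_iff_commute_mk {H : Type*} [Group H] {Q : Subgroup H} [Q.Normal]
    {a b : H} : ⁅a, b⁆ ∈ Q ↔ Commute (a : H ⧸ Q) b := by
  rw [← commutatorElement_eq_one_iff_commute, ← QuotientGroup.coe_mk',
    ← map_commutatorElement, QuotientGroup.coe_mk', QuotientGroup.eq_one_iff]

theorem commutatorElement_mul_mul_of_commute {H : Type*} [Group H] {x y : H} (h : Commute x y)
    (a b : H) : ⁅a * x, b * y⁆ = a * (x * b * x⁻¹) * (y * a * y⁻¹)⁻¹ * b⁻¹ := by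
  have h_split : ⁅a * x, b * y⁆ =
      a * (x * b * x⁻¹) * ⁅x, y⁆ * (y * a * y⁻¹)⁻¹ * b⁻¹ := by
    simp only [commutatorElement_def]
    group
  rw [h_split, commutatorElement_eq_one_iff_commute.2 h, mul_one]

theorem exists_monoidHom_extension_of_commutator {H : Type*} [Group H] [Finite H]
    {N : Subgroup H} (θ : N →* ℂˣ) (hθ : ∀ a b : H, ∃ h : ⁅a, b⁆ ∈ N, θ ⟨_, h⟩ = 1) :
    ∃ θ' : H →* ℂˣ, ∀ n : N, θ' n = θ n := by
  let p : N →* N.map Abelianization.of := Abelianization.of.subgroupMap N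
  have hp : Function.Surjective p := MonoidHom.subgroupMap_surjective _ _
  have h_commutator : commutator H ≤ θ.ker.map N.subtype := by
    rw [commutator_def, Subgroup.commutator_le]
    intro a _ b _
    obtain ⟨h, h_one⟩ := hθ a b
    exact ⟨⟨_, h⟩, h_one, rfl⟩
  have h_ker : p.ker ≤ θ.ker := by
    intro n hn
    have h_of : Abelianization.of (n : H) = 1 := congrArg Subtype.val hn
    rw [← MonoidHom.mem_ker, Abelianization.ker_of] at h_of
    obtain ⟨n', hn', h_eq⟩ := h_commutator h_of
    exact Subtype.ext (a1 := n') (a2 := n) h_eq ▸ hn'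
  let θ₁ : N.map Abelianization.of →* ℂˣ := p.liftOfSurjective hp ⟨θ, h_ker⟩
  have hθ₁ : ∀ n, θ₁ (p n) = θ n :=
    p.liftOfRightInverse_comp_apply _ (Function.rightInverse_surjInv hp) ⟨θ, h_ker⟩
  have : Finite (Abelianization H) := Quotient.finite _
  obtain ⟨θ₂, hθ₂⟩ := MonoidHom.domRestrict_surjective ℂ (N.map Abelianization.of) θ₁
  exact ⟨θ₂.comp Abelianization.of, fun n => (DFunLike.congr_fun hθ₂ (p n)).trans (hθ₁ n)⟩

theorem isComplement'_zpowers_of_sq_eq_one {H : Type*} [Group H] {B : Subgroup H} {x : H}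
    (hxB : x ∉ B) (hx : x ^ 2 = 1) (hB : ∀ y, y ∈ B ∨ x⁻¹ * y ∈ B) :
    (Subgroup.zpowers x).IsComplement' B := by
  refine Subgroup.isComplement'_of_disjoint_and_mul_eq_univ ?_ (Set.eq_univ_of_forall fun y => ?_)
  · rw [Subgroup.disjoint_def]
    rintro _ ⟨k, rfl⟩ hk
    have hx' : x ^ (2 : ℤ) = 1 := by exact_mod_cast hx
    obtain ⟨j, rfl | rfl⟩ := Int.even_or_odd' k
    · simp only [zpow_mul, hx', one_zpow]
    · simp only [zpow_add, zpow_mul, hx', one_zpow, one_mul, zpow_one] at hk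
      exact absurd hk hxB
  · rcases hB y with hy | hy
    · exact Set.mem_mul.2 ⟨1, Subgroup.one_mem _, y, hy, one_mul y⟩
    · exact Set.mem_mul.2 ⟨x, Subgroup.mem_zpowers x, _, hy, mul_inv_cancel_left x y⟩

variable {G : Type*} [Group G] {K : Subgroup G} [K.Normal] {χ : K →* ℂˣ}
  {N M : Subgroup (inertiaGroup χ)}

theorem IsAbelianOver.exists_extends [Finite G] (hN : IsAbelianOver χ N) :
    ∃ χ₁ : N →* ℂˣ, Extends χ χ₁ := by
  obtain ⟨θ, hθ⟩ := exists_monoidHom_extension_of_commutator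
    (χ.comp ((inclG N).subgroupComap K)) fun a b => hN.commutator a a.2 b b.2
  exact ⟨θ, fun n h => hθ ⟨n, h⟩⟩

theorem IsAbelianOver.mul_comm_quotient (hM : IsAbelianOver χ M) (x y : M ⧸ K.comap (inclG M)) :
    x * y = y * x := by
  obtain ⟨a, rfl⟩ := QuotientGroup.mk_surjective x
  obtain ⟨b, rfl⟩ := QuotientGroup.mk_surjective y
  exact commutatorElement_mem_iff_commute_mk.1 (hM.commutator a a.2 b b.2).1

theorem IsAbelianOver.exists_isComplement' [N.Normal] (hN : IsAbelianOver χ N)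
    {e : inertiaGroup χ} (he : e ∈ M) (heN : e ∉ N) (he_sq : ((e ^ 2 : inertiaGroup χ) : G) ∈ K)
    (hM : ∀ m ∈ M, m ∈ N ∨ e⁻¹ * m ∈ N) :
    ∃ B D : Subgroup (M ⧸ K.comap (inclG M)),
      B.Normal ∧ (∀ x ∈ B, ∀ y ∈ B, x * y = y * x) ∧ Nat.card D = 2 ∧ B.IsComplement' D := by
  let q := QuotientGroup.mk' (K.comap (inclG M))
  have hq : Function.Surjective q := QuotientGroup.mk'_surjective _
  let B := (N.subgroupOf M).map q
  have h_mem : ∀ m : M, q m ∈ B ↔ (m : inertiaGroup χ) ∈ N := by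
    refine fun m => ⟨fun ⟨n, hn, h⟩ => ?_, fun h => ⟨m, h, rfl⟩⟩
    have h_mem : n⁻¹ * m ∈ K.comap (inclG M) := QuotientGroup.eq.1 h
    exact (N.mul_mem_cancel_left (N.inv_mem hn)).1 (hN.le h_mem)
  let x := q ⟨e, he⟩
  have hx : x ^ 2 = 1 := (map_pow q _ 2).symm.trans ((QuotientGroup.eq_one_iff _).2 he_sq)
  have hxB : x ∉ B := fun h => heN ((h_mem _).1 h)
  refine ⟨B, Subgroup.zpowers x, Subgroup.Normal.map inferInstance q hq, ?_, ?_,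
    (isComplement'_zpowers_of_sq_eq_one hxB hx fun y => ?_).symm⟩
  · rintro _ ⟨a, ha, rfl⟩ _ ⟨b, hb, rfl⟩
    exact commutatorElement_mem_iff_commute_mk.1 (hN.commutator a ha b hb).1
  · rw [Nat.card_zpowers]
    exact orderOf_eq_prime hx fun h => hxB (h ▸ B.one_mem)
  · obtain ⟨m, rfl⟩ := hq y
    exact (hM m m.2).imp (h_mem m).2 (h_mem (⟨e, he⟩⁻¹ * m)).2

theorem apply_commutatorElement_eq_one [N.Normal] {χ₁ : N →* ℂˣ} {e : inertiaGroup χ}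
    (he : e ∈ inertiaGroup χ₁) {n : inertiaGroup χ} (hn : n ∈ N) (h : ⁅e, n⁆ ∈ N) :
    χ₁ ⟨_, h⟩ = 1 := by
  have h_eq : (⟨_, h⟩ : N) = MulAut.conjNormal e ⟨n, hn⟩ * (⟨n, hn⟩ : N)⁻¹ := Subtype.ext rfl
  rw [h_eq, map_mul, he, map_inv, mul_inv_cancel]

/-- `χ` is trivial on those commutators of `e` with elements of `N` that lie in `K`: a necessary
condition for `e` to stabilize an extension of `χ` to `N`. -/
def IsTrivialOnCommutators (χ : K →* ℂˣ) (N : Subgroup (inertiaGroup χ)) (e : inertiaGroup χ) :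
    Prop :=
  ∀ n ∈ N, ∀ h : ((⁅e, n⁆ : inertiaGroup χ) : G) ∈ K, χ ⟨_, h⟩ = 1

theorem Extends.isTrivialOnCommutators [N.Normal] (hN : K.subgroupOf (inertiaGroup χ) ≤ N)
    {χ₁ : N →* ℂˣ} (h_ext : Extends χ χ₁) {e : inertiaGroup χ} (he : e ∈ inertiaGroup χ₁) :
    IsTrivialOnCommutators χ N e := fun n hn h =>
  (h_ext ⟨⁅e, n⁆, hN h⟩ h).symm.trans (apply_commutatorElement_eq_one he hn _)

theorem le_inertiaGroup_comp_inclusion [N.Normal] (hNM : N ≤ M) (χ' : M →* ℂˣ) :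
    M ≤ inertiaGroup (χ'.comp (Subgroup.inclusion hNM)) := by
  intro m hm n
  have h_conj : Subgroup.inclusion hNM (MulAut.conjNormal m n) =
      ⟨m, hm⟩ * Subgroup.inclusion hNM n * (⟨m, hm⟩ : M)⁻¹ := Subtype.ext rfl
  rw [MonoidHom.comp_apply, h_conj, map_mul, map_mul, map_inv, mul_comm, inv_mul_cancel_left]
  rfl

/-- `M` contains the stabilizers of all extensions of `χ` to `N`, and `χ` extends to `M`, so that
`M` is itself the stabilizer of one of these extensions. -/
structure IsLargestStabilizer (χ : K →* ℂˣ) (N M : Subgroup (inertiaGroup χ)) [N.Normal] :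
    Prop where
  le : N ≤ M
  inertiaGroup_le : ∀ χ₁ : N →* ℂˣ, Extends χ χ₁ → inertiaGroup χ₁ ≤ M
  exists_extends : ∃ χ' : M →* ℂˣ, Extends χ χ'

namespace IsLargestStabilizer

variable [Finite G] [N.Normal] {C : Subgroup G}

theorem eq_of_isCliffordSubgroup (hM : IsLargestStabilizer χ N M)
    (hC : C.subgroupOf (inertiaGroup χ) = N) {M' : Subgroup (inertiaGroup χ)}
    (hM' : IsCliffordSubgroup C χ M') : M' = M := by
  have := hM'.normal
  have hNM' : N ≤ M' := by
    rintro n hn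
    obtain ⟨m, hm, h_eq⟩ := hM'.le (hC.ge hn)
    exact Subtype.ext h_eq ▸ hm
  obtain ⟨θ, hθ⟩ := hM'.extends_char
  obtain ⟨χ', hχ'⟩ := hM.exists_extends
  have h_le : M' ≤ M := (le_inertiaGroup_comp_inclusion hNM' θ).trans
    (hM.inertiaGroup_le _ fun n h => hθ (Subgroup.inclusion hNM' n) h)
  exact h_le.antisymm (le_of_extends_of_ind_isIrreducible h_le hχ' hM'.ind_irreducible)

theorem inductionBijective [M.Normal] (hM : IsLargestStabilizer χ N M) (hN : IsAbelianOver χ N) :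
    InductionBijective χ M :=
  inductionBijective_of_ind_isIrreducible (hN.le.trans hM.le)
    (IrrOver.ind_isIrreducible hN hM.le hM.inertiaGroup_le)

theorem isCliffordSubgroup [M.Normal] (hM : IsLargestStabilizer χ N M) (hN : IsAbelianOver χ N)
    (hCχ : C ≤ inertiaGroup χ) (hC : C.subgroupOf (inertiaGroup χ) = N)
    (h : IsAbelianOver χ M ∨ ∃ e ∈ M, e ∉ N ∧ ((e ^ 2 : inertiaGroup χ) : G) ∈ K ∧
      ∀ m ∈ M, m ∈ N ∨ e⁻¹ * m ∈ N) :
    IsCliffordSubgroup C χ M where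
  normal := inferInstance
  le c hc := ⟨⟨c, hCχ hc⟩, hM.le (hC.le hc), rfl⟩
  extends_char := hM.exists_extends
  ind_irreducible := IrrOver.ind_isIrreducible hN hM.le hM.inertiaGroup_le
  ind_surjective :=
    IrrOver.exists_equiv_ind (IrrOver.ind_isIrreducible hN hM.le hM.inertiaGroup_le)
  quotient_structure := h.imp IsAbelianOver.mul_comm_quotient fun ⟨_, he, heN, he_sq, h_cover⟩ =>
    hN.exists_isComplement' he heN he_sq h_cover
  dim_one_or_two ρ := h.elim (fun hM' => .inl (ρ.finrank_eq_one hM')) fun ⟨_, he, _, _, h_cover⟩ =>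
    ρ.finrank_eq_one_or_two hN hM.le he h_cover
  bijection := (hM.inductionBijective hN).nonempty

end IsLargestStabilizer

/-- `E` is a set of commuting representatives of the cosets of `N` in the inertia group of `χ`,
with squares in `K`. -/
structure IsTransversalOver (χ : K →* ℂˣ) (N : Subgroup (inertiaGroup χ))
    (E : Set (inertiaGroup χ)) : Prop where
  exists_mul : ∀ c, ∃ n ∈ N, ∃ e ∈ E, c = n * e
  commute : ∀ e ∈ E, ∀ e' ∈ E, Commute e e'
  sq_mem : ∀ e ∈ E, ((e ^ 2 : inertiaGroup χ) : G) ∈ K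

namespace IsTransversalOver

variable {E : Set (inertiaGroup χ)} [N.Normal] {χ₁ : N →* ℂˣ}

theorem commutator_mem (hE : IsTransversalOver χ N E) (a b : inertiaGroup χ) : ⁅a, b⁆ ∈ N := by
  obtain ⟨n, hn, e, he, rfl⟩ := hE.exists_mul a
  obtain ⟨n', hn', e', he', rfl⟩ := hE.exists_mul b
  rw [commutatorElement_mul_mul_of_commute (hE.commute e he e' he')]
  have h_conj : ∀ x ∈ N, ∀ g, g * x * g⁻¹ ∈ N := Subgroup.Normal.conj_mem inferInstance
  exact N.mul_mem (N.mul_mem (N.mul_mem hn (h_conj _ hn' _)) (N.inv_mem (h_conj _ hn _)))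
    (N.inv_mem hn')

theorem normal_of_le (hE : IsTransversalOver χ N E) (hNM : N ≤ M) : M.Normal :=
  ⟨fun m hm c => (M.mul_mem_cancel_right (M.inv_mem hm)).1 (hNM (hE.commutator_mem c m))⟩

theorem exists_mul_of_mem_inertiaGroup (hE : IsTransversalOver χ N E) {a : inertiaGroup χ}
    (ha : a ∈ inertiaGroup χ₁) : ∃ n ∈ N, ∃ e ∈ E, e ∈ inertiaGroup χ₁ ∧ a = n * e := by
  obtain ⟨n, hn, e, he, rfl⟩ := hE.exists_mul a
  exact ⟨n, hn, e, he, (Subgroup.mul_mem_cancel_left _ (le_inertiaGroup χ₁ hn)).1 ha, rfl⟩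

theorem apply_commutator_eq_one (hE : IsTransversalOver χ N E) {a b : inertiaGroup χ}
    (ha : a ∈ inertiaGroup χ₁) (hb : b ∈ inertiaGroup χ₁) :
    χ₁ ⟨_, hE.commutator_mem a b⟩ = 1 := by
  obtain ⟨n, hn, e, he, he_stab, rfl⟩ := hE.exists_mul_of_mem_inertiaGroup ha
  obtain ⟨n', hn', e', he', he_stab', rfl⟩ := hE.exists_mul_of_mem_inertiaGroup hb
  have h_eq : (⟨_, hE.commutator_mem (n * e) (n' * e')⟩ : N) =
      ⟨n, hn⟩ * MulAut.conjNormal e ⟨n', hn'⟩ * (MulAut.conjNormal e' ⟨n, hn⟩)⁻¹ *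
        (⟨n', hn'⟩ : N)⁻¹ :=
    Subtype.ext (commutatorElement_mul_mul_of_commute (hE.commute e he e' he') n n')
  rw [h_eq, map_mul, map_mul, map_mul, map_inv, map_inv, he_stab, he_stab',
    mul_comm (χ₁ ⟨n, hn⟩), mul_inv_cancel_right, mul_inv_cancel]

theorem isLargestStabilizer [Finite G] (hE : IsTransversalOver χ N E)
    (hN : K.subgroupOf (inertiaGroup χ) ≤ N) (h_ext : Extends χ χ₁)
    (h_le : ∀ χ₂ : N →* ℂˣ, Extends χ χ₂ → inertiaGroup χ₂ ≤ inertiaGroup χ₁) :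
    IsLargestStabilizer χ N (inertiaGroup χ₁) := by
  obtain ⟨θ, hθ⟩ := exists_monoidHom_extension_of_commutator
    (χ₁.comp ((inertiaGroup χ₁).subtype.subgroupComap N)) fun a b =>
      ⟨hE.commutator_mem a b, hE.apply_commutator_eq_one a.2 b.2⟩
  exact ⟨le_inertiaGroup χ₁, h_le, θ, fun n h => (hθ ⟨n, hN h⟩).trans (h_ext _ h)⟩

theorem isAbelianOver_inertiaGroup (hE : IsTransversalOver χ N E) (hN : IsAbelianOver χ N)
    (h_ext : Extends χ χ₁)
    (h : ∀ g ∈ inertiaGroup χ₁, ∀ n ∈ N, ((⁅g, n⁆ : inertiaGroup χ) : G) ∈ K) :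
    IsAbelianOver χ (inertiaGroup χ₁) := by
  refine ⟨hN.le.trans (le_inertiaGroup χ₁), fun a ha b hb => ?_⟩
  suffices h_mem : ⁅a, b⁆ ∈ K.subgroupOf (inertiaGroup χ) from
    ⟨h_mem, (h_ext ⟨_, hE.commutator_mem a b⟩ h_mem).symm.trans
      (hE.apply_commutator_eq_one ha hb)⟩
  have h_comm : ∀ g ∈ inertiaGroup χ₁, ∀ n ∈ N, Commute
      (g : inertiaGroup χ ⧸ K.subgroupOf (inertiaGroup χ)) n := fun g hg n hn =>
    commutatorElement_mem_iff_commute_mk.1 (h g hg n hn)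
  obtain ⟨n, hn, e, he, he_stab, rfl⟩ := hE.exists_mul_of_mem_inertiaGroup ha
  obtain ⟨n', hn', e', he', he_stab', rfl⟩ := hE.exists_mul_of_mem_inertiaGroup hb
  rw [commutatorElement_mem_iff_commute_mk, QuotientGroup.mk_mul, QuotientGroup.mk_mul]
  have h_ee' := (hE.commute e he e' he').map (QuotientGroup.mk' (K.subgroupOf (inertiaGroup χ)))
  have h_nn' := h_comm n (le_inertiaGroup χ₁ hn) n' hn'
  exact (h_nn'.mul_right (h_comm e' he_stab' n hn).symm).mul_left
    ((h_comm e he_stab n' hn').mul_right h_ee')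

/-- If all commutators of stabilizers of extensions with `N` lie in `K`, then the extensions, which
agree on `K`, have the same stabilizer. -/
theorem exists_isLargestStabilizer_of_commutator_mem [Finite G] (hE : IsTransversalOver χ N E)
    (hN : IsAbelianOver χ N)
    (h : ∀ χ₁ : N →* ℂˣ, Extends χ χ₁ → ∀ g ∈ inertiaGroup χ₁, ∀ n ∈ N,
      ((⁅g, n⁆ : inertiaGroup χ) : G) ∈ K) :
    ∃ M, IsLargestStabilizer χ N M ∧ IsAbelianOver χ M := by
  obtain ⟨χ₁, h_ext⟩ := hN.exists_extends
  refine ⟨inertiaGroup χ₁, hE.isLargestStabilizer hN.le h_ext fun χ₂ h_ext₂ g hg n => ?_,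
    hE.isAbelianOver_inertiaGroup hN h_ext (h χ₁ h_ext)⟩
  have hk : ((⁅g, n⁆ : inertiaGroup χ) : G) ∈ K := h χ₂ h_ext₂ g hg n n.2
  have h_conj : MulAut.conjNormal g n = (⟨⁅g, n⁆, hN.le hk⟩ : N) * n :=
    Subtype.ext (inv_mul_cancel_right (g * n * g⁻¹) (n : inertiaGroup χ)).symm
  have h_one : χ₁ ⟨⁅g, n⁆, hN.le hk⟩ = 1 :=
    (h_ext ⟨⁅g, n⁆, hN.le hk⟩ hk).trans (h_ext₂.isTrivialOnCommutators hN.le hg n n.2 hk)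
  rw [h_conj, map_mul, h_one, one_mul]

theorem exists_isLargestStabilizer_of_commutator_notMem [Finite G]
    (hE : IsTransversalOver χ N E) (hN : IsAbelianOver χ N)
    (h_unique : ∀ e ∈ E, ∀ e' ∈ E, IsTrivialOnCommutators χ N e → IsTrivialOnCommutators χ N e' →
      e' ∉ N → (∃ n ∈ N, ((⁅e, n⁆ : inertiaGroup χ) : G) ∉ K) → e⁻¹ * e' ∈ N)
    (h_ext : Extends χ χ₁) {g n : inertiaGroup χ} (hg : g ∈ inertiaGroup χ₁) (hn : n ∈ N)
    (hk : ((⁅g, n⁆ : inertiaGroup χ) : G) ∉ K) :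
    ∃ M, IsLargestStabilizer χ N M ∧ ∃ e ∈ M, e ∉ N ∧ ((e ^ 2 : inertiaGroup χ) : G) ∈ K ∧
      ∀ m ∈ M, m ∈ N ∨ e⁻¹ * m ∈ N := by
  obtain ⟨n₀, hn₀, e, he, he_stab, rfl⟩ := hE.exists_mul_of_mem_inertiaGroup hg
  have hek : ((⁅e, n⁆ : inertiaGroup χ) : G) ∉ K := fun h => hk <| by
    have h₀ := commutatorElement_mem_iff_commute_mk (Q := K.subgroupOf _).1
      (hN.commutator n₀ hn₀ n hn).1
    exact commutatorElement_mem_iff_commute_mk (Q := K.subgroupOf _).2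
      (h₀.mul_left (commutatorElement_mem_iff_commute_mk (Q := K.subgroupOf _).1 h))
  have heN : e ∉ N := fun h => hek (hN.commutator e h n hn).1
  have h_cover : ∀ θ : N →* ℂˣ, Extends χ θ → ∀ m ∈ inertiaGroup θ, m ∈ N ∨ e⁻¹ * m ∈ N := by
    intro θ hθ m hm
    obtain ⟨n', hn', e', he', he_stab', rfl⟩ := hE.exists_mul_of_mem_inertiaGroup hm
    refine or_iff_not_imp_left.2 fun h => ?_
    have h_mem : e⁻¹ * e' ∈ N := h_unique e he e' he'
      (h_ext.isTrivialOnCommutators hN.le he_stab) (hθ.isTrivialOnCommutators hN.le he_stab')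
      (fun h' => h (N.mul_mem hn' h')) ⟨n, hn, hek⟩
    have h_conj : e⁻¹ * n' * e ∈ N := by
      simpa using Subgroup.Normal.conj_mem (H := N) inferInstance n' hn' e⁻¹
    simpa [mul_assoc] using N.mul_mem h_conj h_mem
  refine ⟨inertiaGroup χ₁, hE.isLargestStabilizer hN.le h_ext fun χ₂ h_ext₂ m hm => ?_,
    e, he_stab, heN, hE.sq_mem e he, h_cover χ₁ h_ext⟩
  rcases h_cover χ₂ h_ext₂ m hm with h | h
  · exact le_inertiaGroup χ₁ h
  · exact (Subgroup.mul_mem_cancel_left _ (Subgroup.inv_mem _ he_stab)).1 (le_inertiaGroup χ₁ h)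

theorem existsUnique_isCliffordSubgroup [Finite G] {C : Subgroup G}
    (hE : IsTransversalOver χ N E) (hN : IsAbelianOver χ N)
    (hCχ : C ≤ inertiaGroup χ) (hC : C.subgroupOf (inertiaGroup χ) = N)
    (h_unique : ∀ e ∈ E, ∀ e' ∈ E, IsTrivialOnCommutators χ N e → IsTrivialOnCommutators χ N e' →
      e' ∉ N → (∃ n ∈ N, ((⁅e, n⁆ : inertiaGroup χ) : G) ∉ K) → e⁻¹ * e' ∈ N) :
    (∃! M : Subgroup (inertiaGroup χ), IsCliffordSubgroup C χ M) ∧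
      ∀ (M : Subgroup (inertiaGroup χ)) [M.Normal],
        IsCliffordSubgroup C χ M → InductionBijective χ M := by
  obtain ⟨M, hM, h_structure⟩ : ∃ M, IsLargestStabilizer χ N M ∧ (IsAbelianOver χ M ∨
      ∃ e ∈ M, e ∉ N ∧ ((e ^ 2 : inertiaGroup χ) : G) ∈ K ∧ ∀ m ∈ M, m ∈ N ∨ e⁻¹ * m ∈ N) := by
    by_cases h : ∀ χ₁ : N →* ℂˣ, Extends χ χ₁ → ∀ g ∈ inertiaGroup χ₁, ∀ n ∈ N,
        ((⁅g, n⁆ : inertiaGroup χ) : G) ∈ K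
    · exact (hE.exists_isLargestStabilizer_of_commutator_mem hN h).imp fun _ => .imp_right .inl
    · push Not at h
      obtain ⟨χ₁, h_ext, g, hg, n, hn, hk⟩ := h
      exact (hE.exists_isLargestStabilizer_of_commutator_notMem hN h_unique h_ext hg hn hk).imp
        fun _ => .imp_right .inr
  have := hE.normal_of_le hM.le
  refine ⟨⟨M, hM.isCliffordSubgroup hN hCχ hC h_structure,
    fun M' hM' => hM.eq_of_isCliffordSubgroup hC hM'⟩, fun M' _ hM' => ?_⟩
  obtain rfl := hM.eq_of_isCliffordSubgroup hC hM'
  exact hM.inductionBijective hN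

end IsTransversalOver

end Stabilizers

section Arithmetic

/-- The kernel of `φ` has square zero, as for the projection `𝔬_{2ℓ} → 𝔬_ℓ`. Noncommutative rings
are allowed, so that the notion applies to matrix rings. -/
def HasSquareZeroKernel {R R' : Type*} [Ring R] [Ring R'] (φ : R →+* R') : Prop :=
  ∀ ⦃a b⦄, φ a = 0 → φ b = 0 → a * b = 0

namespace HasSquareZeroKernel

variable {R R' : Type*} [Ring R] [Ring R'] {φ : R →+* R'}

theorem mul_eq_mul_of_map_eq (hφ : HasSquareZeroKernel φ) {a b c : R} (ha : φ a = 0)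
    (hbc : φ b = φ c) : a * b = a * c := by
  rw [← sub_eq_zero, ← mul_sub]
  exact hφ ha (by rw [map_sub, hbc, sub_self])

theorem isUnit_of_map_eq_one (hφ : HasSquareZeroKernel φ) {a : R} (ha : φ a = 1) : IsUnit a := by
  have h_ker : φ (a - 1) = 0 := by rw [map_sub, ha, map_one, sub_self]
  have h_nil : IsNilpotent (a - 1) := ⟨2, (pow_two _).trans (hφ h_ker h_ker)⟩
  simpa only [add_sub_cancel] using h_nil.isUnit_one_add

theorem isUnit_of_map (hφ : HasSquareZeroKernel φ) (h_surj : Function.Surjective φ) {a : R}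
    (ha : IsUnit (φ a)) : IsUnit a := by
  obtain ⟨u, hu⟩ := ha
  obtain ⟨b, hb⟩ := h_surj ↑u⁻¹
  have hab : IsUnit (a * b) := hφ.isUnit_of_map_eq_one (by rw [map_mul, hb, ← hu, u.mul_inv])
  have hba : IsUnit (b * a) := hφ.isUnit_of_map_eq_one (by rw [map_mul, hb, ← hu, u.inv_mul])
  obtain ⟨c, hc⟩ := hab.exists_right_inv
  obtain ⟨c', hc'⟩ := hba.exists_left_inv
  exact isUnit_iff_exists_and_exists.2
    ⟨⟨b * c, by rw [← mul_assoc, hc]⟩, ⟨c' * b, by rw [mul_assoc, hc']⟩⟩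

end HasSquareZeroKernel

variable {R R' : Type*} [CommRing R] [CommRing R'] {φ : R →+* R'} {ψ : AddChar R ℂˣ}

/-- The additive character `ψ` separates the elements outside the kernel of `φ`: the nondegeneracy
of a primitive character of `𝔬_{2ℓ}` relative to the projection to `𝔬_ℓ`. It is stated for pairs of
elements, whose product is detected by a multiplier `s` that sends both factors to the kernel. -/
def IsPrimitiveOver (φ : R →+* R') (ψ : AddChar R ℂˣ) : Prop :=
  ∀ ⦃a b⦄, φ a ≠ 0 → φ b ≠ 0 →
    ∃ s, (∀ r, IsUnit (1 + s * r)) ∧ φ (s * a) = 0 ∧ φ (s * b) = 0 ∧ ψ (s * a * b) ≠ 1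

theorem IsPrimitiveOver.map_eq_zero (hψ : IsPrimitiveOver φ ψ) {y : R}
    (hy : ∀ u, φ u = 0 → ψ (y * u) = 1) : φ y = 0 := by
  by_contra h
  have h_one : φ 1 ≠ 0 := fun h' => h (by rw [← mul_one y, map_mul, h', mul_zero])
  obtain ⟨s, -, -, hs, hne⟩ := hψ h h_one
  exact hne (by rw [mul_right_comm, mul_one, mul_comm]; exact hy s (by rwa [mul_one] at hs))

/-- The norm form `p² + t p q + d q²`, that is, the determinant of `p + q A` for a `2 × 2` matrix
`A` with trace `t` and determinant `d`. -/
def normForm (t d p q : R) : R :=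
  p ^ 2 + t * p * q + d * q ^ 2

theorem map_normForm (φ : R →+* R') (t d p q : R) :
    φ (normForm t d p q) = normForm (φ t) (φ d) (φ p) (φ q) := by
  simp only [normForm, map_add, map_mul, map_pow]

/-- The condition on `x` for `ψ_{[A]}` to be trivial on the commutators in `K^ℓ` of the unipotent
element with entry `x` and the elements of the stabilizer of `ψ_A`. -/
def IsTrivialOnNormOne (φ : R →+* R') (ψ : AddChar R ℂˣ) (t d x : R) : Prop :=
  ∀ p q, IsUnit p → φ (normForm t d p q) = 1 → φ (x * q) = 0 →
    ψ (x * (1 - normForm t d p q) - x ^ 2 * p * q) = 1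

namespace IsTrivialOnNormOne

variable {t d x y p q : R}

/-- The condition is evaluated at the element `1 + s (p + q A - 1)`, whose norm is congruent to one
by `hsT`. -/
theorem apply_eq_one (hx : IsTrivialOnNormOne φ ψ t d x) (hpq : φ (normForm t d p q) = 1) {s : R}
    (hs : ∀ r, IsUnit (1 + s * r)) (hsT : φ (s * (2 * p + t * q - 2)) = 0)
    (hsq : φ (s * q * x) = 0) :
    ψ (-(s * x * (1 - s) * (2 * p + t * q - 2) + s ^ 2 * x * (normForm t d p q - 1))
      - s * x ^ 2 * (1 + s * (p - 1)) * q) = 1 := by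
  have h_norm : normForm t d (1 + s * (p - 1)) (s * q) =
      1 + s * (2 * p + t * q - 2) * (1 - s) + s ^ 2 * (normForm t d p q - 1) := by
    simp only [normForm]
    ring
  have h_one := hx (1 + s * (p - 1)) (s * q) (hs _) ?_ (by rwa [mul_comm])
  · rw [h_norm] at h_one
    rw [← h_one]
    congr 1
    ring
  · rw [h_norm, map_add, map_add, map_mul, map_mul φ (s ^ 2), hsT, map_sub φ _ 1, hpq, map_one,
      zero_mul, sub_self, mul_zero, add_zero, add_zero]

theorem map_trace_eq_zero (hφ : HasSquareZeroKernel φ) (hψ : IsPrimitiveOver φ ψ)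
    (hx : IsTrivialOnNormOne φ ψ t d x) (hx0 : φ x ≠ 0) (hpq : φ (normForm t d p q) = 1) :
    φ (2 * (p - 1) + q * (t + x)) = 0 := by
  by_contra hτ
  obtain ⟨s, hs, hsx, hsτ, hne⟩ := hψ hx0 hτ
  have hν : φ (normForm t d p q - 1) = 0 := by rw [map_sub, hpq, map_one, sub_self]
  have hsT : φ (s * (2 * p + t * q - 2)) = 0 := by
    have h_eq : s * (2 * p + t * q - 2) = s * (2 * (p - 1) + q * (t + x)) - q * (s * x) := by ring
    rw [h_eq, map_sub, map_mul φ q, hsτ, hsx, mul_zero, sub_zero]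
  have hsq : φ (s * q * x) = 0 := by rw [mul_right_comm, map_mul, hsx, zero_mul]
  have h_one := hx.apply_eq_one hpq hs hsT hsq
  refine hne ?_
  rw [← inv_inj, ← AddChar.map_neg_eq_inv, inv_one, ← h_one]
  congr 1
  linear_combination (-1 : R) * hφ hsx hsT + s * hφ hsx hν + (p - 1) * q * hφ hsx hsx

/-- The conditions for `x` and `y` are compared at the same element `1 + s (p + q A - 1)`. -/
theorem map_eq_map (hφ : HasSquareZeroKernel φ) (hψ : IsPrimitiveOver φ ψ)
    (hx : IsTrivialOnNormOne φ ψ t d x) (hy : IsTrivialOnNormOne φ ψ t d y) (hy0 : φ y ≠ 0)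
    (hy2 : φ (2 * y) = 0) (hpq : φ (normForm t d p q) = 1) (hqx : φ (q * x) ≠ 0) :
    φ x = φ y := by
  have hx0 : φ x ≠ 0 := fun h => hqx (by rw [map_mul, h, mul_zero])
  have hTx := hx.map_trace_eq_zero hφ hψ hx0 hpq
  have hTy := hy.map_trace_eq_zero hφ hψ hy0 hpq
  have hν : φ (normForm t d p q - 1) = 0 := by rw [map_sub, hpq, map_one, sub_self]
  simp only [map_add, map_mul, map_sub, map_one, map_ofNat] at hTx hTy hy2 hqx
  have hqs : φ (q * (x + y)) = 0 := by
    simp only [map_add, map_mul]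
    linear_combination hTx - hTy + φ q * hy2
  have hT0 : φ (2 * p + t * q - 2) ≠ 0 := by
    refine fun h => hqx ?_
    simp only [map_add, map_mul, map_sub, map_ofNat] at h
    linear_combination hTx - h
  by_contra hne
  obtain ⟨s, hs, hsz, hsT, h_ne⟩ := hψ (a := x - y) (by rwa [map_sub, sub_ne_zero]) hT0
  have hsx : φ (s * q * x) = 0 := by
    simp only [map_add, map_mul, map_sub, map_ofNat] at hsT ⊢
    linear_combination φ s * hTx - hsT
  have hsy : φ (s * q * y) = 0 := by
    simp only [map_mul] at hsx ⊢
    linear_combination hsx - φ s * (hTx - hTy)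
  have h_quot := (ψ.map_sub_eq_div _ _).trans
    (congrArg₂ (· / ·) (hy.apply_eq_one hpq hs hsT hsy) (hx.apply_eq_one hpq hs hsT hsx))
  refine h_ne (Eq.trans ?_ (h_quot.trans (div_one 1)))
  congr 1
  linear_combination hφ hsz hsT - s * hφ hsz hν - (1 + s * (p - 1)) * hφ hsz hqs

end IsTrivialOnNormOne

theorem hasSquareZeroKernel_truncMap {𝒪 : Type*} [CommRing 𝒪] [IsLocalRing 𝒪] {ℓ : ℕ} :
    HasSquareZeroKernel (truncMap 𝒪 ℓ) :=
  fun _ _ => mul_eq_zero_of_truncMap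

theorem mk_irreducible_pow_eq_zero {𝒪 : Type*} [CommRing 𝒪] [IsLocalRing 𝒪] {ϖ : 𝒪}
    (hϖ : Irreducible ϖ) {i n : ℕ} (hi : n ≤ i) :
    (Ideal.Quotient.mk _ ϖ : TruncRing 𝒪 n) ^ i = 0 := by
  rw [← map_pow, Ideal.Quotient.eq_zero_iff_mem]
  exact Ideal.pow_le_pow_right hi (Ideal.pow_mem_pow ((mem_maximalIdeal _).2 hϖ.not_isUnit) i)

theorem truncMap_mul_pow_eq_zero {𝒪 : Type*} [CommRing 𝒪] [IsLocalRing 𝒪] {ℓ : ℕ} {ϖ : 𝒪}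
    (hϖ : Irreducible ϖ) (a : TruncRing 𝒪 (2 * ℓ)) {i : ℕ} (hi : ℓ ≤ i) :
    truncMap 𝒪 ℓ (a * Ideal.Quotient.mk _ ϖ ^ i) = 0 := by
  rw [map_mul, map_pow, Ideal.Quotient.factor_mk, mk_irreducible_pow_eq_zero hϖ hi, mul_zero]

theorem exists_eq_unit_mul_pow_of_truncMap_ne_zero {𝒪 : Type*} [CommRing 𝒪] [IsDomain 𝒪]
    [IsDiscreteValuationRing 𝒪] {ℓ : ℕ} {ϖ : 𝒪} (hϖ : Irreducible ϖ) {a : TruncRing 𝒪 (2 * ℓ)}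
    (ha : truncMap 𝒪 ℓ a ≠ 0) :
    ∃ i < ℓ, ∃ u : (TruncRing 𝒪 (2 * ℓ))ˣ,
      a = u * (Ideal.Quotient.mk _ ϖ : TruncRing 𝒪 (2 * ℓ)) ^ i := by
  obtain ⟨a, rfl⟩ := Ideal.Quotient.mk_surjective a
  have ha0 : a ≠ 0 := by
    rintro rfl
    exact ha ((congrArg _ (map_zero _)).trans (map_zero _))
  obtain ⟨i, u, rfl⟩ := IsDiscreteValuationRing.eq_unit_mul_pow_irreducible ha0 hϖ
  have h_eq : Ideal.Quotient.mk (maximalIdeal 𝒪 ^ (2 * ℓ)) (u * ϖ ^ i) =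
      u.map (Ideal.Quotient.mk (maximalIdeal 𝒪 ^ (2 * ℓ))).toMonoidHom *
        (Ideal.Quotient.mk _ ϖ : TruncRing 𝒪 (2 * ℓ)) ^ i := by
    rw [map_mul, map_pow]
    rfl
  refine ⟨i, not_le.1 fun hi => ha ?_, _, h_eq⟩
  rw [h_eq, truncMap_mul_pow_eq_zero hϖ _ hi]

theorem isPrimitiveOver_truncMap {𝒪 : Type*} [CommRing 𝒪] [IsDomain 𝒪]
    [IsDiscreteValuationRing 𝒪] {ℓ : ℕ} {ϖ : 𝒪} (hϖ : Irreducible ϖ)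
    (ψ : AddChar (TruncRing 𝒪 (2 * ℓ)) ℂˣ)
    (hψ : ψ (Ideal.Quotient.mk _ (ϖ ^ (2 * ℓ - 1))) ≠ 1) :
    IsPrimitiveOver (truncMap 𝒪 ℓ) ψ := by
  intro a b ha hb
  obtain ⟨i, hi, u, rfl⟩ := exists_eq_unit_mul_pow_of_truncMap_ne_zero hϖ ha
  obtain ⟨j, hj, v, rfl⟩ := exists_eq_unit_mul_pow_of_truncMap_ne_zero hϖ hb
  obtain ⟨k, hk⟩ : ∃ k, 2 * ℓ - 1 = k + i + j := ⟨2 * ℓ - 1 - i - j, by omega⟩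
  set w : TruncRing 𝒪 (2 * ℓ) := Ideal.Quotient.mk _ ϖ
  refine ⟨↑(u * v)⁻¹ * w ^ k, fun r => IsNilpotent.isUnit_one_add ⟨2 * ℓ, ?_⟩, ?_, ?_, ?_⟩
  · rw [mul_pow, mul_pow, ← pow_mul,
      mk_irreducible_pow_eq_zero hϖ (Nat.le_mul_of_pos_left _ (by omega)), mul_zero, zero_mul]
  · rw [mul_mul_mul_comm, ← pow_add, truncMap_mul_pow_eq_zero hϖ _ (by omega)]
  · rw [mul_mul_mul_comm, ← pow_add, truncMap_mul_pow_eq_zero hϖ _ (by omega)]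
  · have h_prod : ↑(u * v)⁻¹ * w ^ k * (u * w ^ i) * (v * w ^ j) =
        (↑(u * v)⁻¹ * ↑(u * v)) * (w ^ k * w ^ i * w ^ j) := by
      rw [Units.val_mul]
      ring
    rwa [h_prod, Units.inv_mul, one_mul, ← pow_add, ← pow_add, ← map_pow, ← hk]

end Arithmetic

section MatrixCongruences

open Matrix
open scoped commutatorElement

variable {R R' : Type*} [CommRing R] [CommRing R'] {φ : R →+* R'} {ψ : AddChar R ℂˣ}
  {n : Type*} [Fintype n] [DecidableEq n]

theorem HasSquareZeroKernel.mapMatrix (hφ : HasSquareZeroKernel φ) :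
    HasSquareZeroKernel (φ.mapMatrix : Matrix n n R →+* Matrix n n R') := by
  intro X Y hX hY
  ext i j
  exact Finset.sum_eq_zero fun k _ => hφ (congrFun₂ hX i k) (congrFun₂ hY k j)

namespace IsPrimitiveOver

theorem mapMatrix_eq_zero (hψ : IsPrimitiveOver φ ψ) {Y : Matrix n n R}
    (hY : ∀ X, φ.mapMatrix X = 0 → ψ (trace (Y * X)) = 1) : φ.mapMatrix Y = 0 := by
  ext i j
  refine hψ.map_eq_zero fun u hu => ?_
  have h_single := hY (single j i u) (by simp [hu])
  rwa [trace_mul_comm, trace_single_mul, smul_eq_mul, mul_comm] at h_single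

/-- Matrices of trace zero detect a matrix up to scalars: off-diagonal entries are detected by
`single j i u`, differences of diagonal entries by `single i i u - single j j u`. -/
theorem exists_mapMatrix_eq_smul_one [Nonempty n] (hψ : IsPrimitiveOver φ ψ) {Y : Matrix n n R}
    (hY : ∀ X, φ.mapMatrix X = 0 → trace X = 0 → ψ (trace (Y * X)) = 1) :
    ∃ y, φ.mapMatrix Y = φ y • 1 := by
  obtain ⟨k⟩ := ‹Nonempty n›
  refine ⟨Y k k, ?_⟩
  ext i j
  rcases eq_or_ne i j with rfl | hij
  · have h_diag : φ (Y i i - Y k k) = 0 := by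
      refine hψ.map_eq_zero fun u hu => ?_
      have h_single := hY (single i i u - single k k u) (by rw [map_sub]; simp [hu]) (by simp)
      rwa [mul_sub, trace_sub, trace_mul_comm, trace_single_mul, trace_mul_comm,
        trace_single_mul, smul_eq_mul, smul_eq_mul, mul_comm, mul_comm u, ← sub_mul] at h_single
    rw [map_sub, sub_eq_zero] at h_diag
    simpa using h_diag
  · have h_off : φ (Y i j) = 0 := by
      refine hψ.map_eq_zero fun u hu => ?_
      have h_single := hY (single j i u) (by simp [hu]) (trace_single_eq_of_ne _ _ _ hij.symm)
      rwa [trace_mul_comm, trace_single_mul, smul_eq_mul, mul_comm] at h_single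
    simpa [hij] using h_off

end IsPrimitiveOver

theorem trace_mul_conj_sub (A X : Matrix n n R) (u : GL n R) :
    trace (A * (u.1 * X * u⁻¹.1)) - trace (A * X) = trace ((u⁻¹.1 * A * u.1 - A) * X) := by
  rw [sub_mul, trace_sub, ← mul_assoc, trace_mul_comm (A * _)]
  simp only [mul_assoc]

theorem map_trace_conj_eq_iff (ψ : AddChar R ℂˣ) (A X : Matrix n n R) (u : GL n R) :
    ψ (trace (A * (u.1 * X * u⁻¹.1))) = ψ (trace (A * X)) ↔
      ψ (trace ((u⁻¹.1 * A * u.1 - A) * X)) = 1 := by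
  rw [← trace_mul_conj_sub, AddChar.map_sub_eq_div, div_eq_one]

theorem semiconjBy_conj_sub {S : Type*} [Ring S] (a : S) (u : Sˣ) :
    SemiconjBy (u : S) (a + (↑u⁻¹ * a * u - a)) a := by
  rw [add_sub_cancel]
  exact (congrArg _ (mul_assoc ..)).trans (u.mul_inv_cancel_left _)

theorem IsPrimitiveOver.forall_map_trace_conj_eq_iff (hφ : HasSquareZeroKernel φ)
    (hψ : IsPrimitiveOver φ ψ) {A : Matrix n n R} {u : GL n R} :
    (∀ X, φ.mapMatrix X = 0 → ψ (trace (A * (u.1 * X * u⁻¹.1))) = ψ (trace (A * X))) ↔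
      Commute (φ.mapMatrix u.1) (φ.mapMatrix A) := by
  simp only [map_trace_conj_eq_iff]
  constructor
  · intro h
    have h_semiconj := (semiconjBy_conj_sub A u).map φ.mapMatrix
    rwa [map_add, hψ.mapMatrix_eq_zero h, add_zero] at h_semiconj
  · intro h X hX
    have h_zero : φ.mapMatrix (u⁻¹.1 * A * u.1 - A) = 0 := by
      rw [map_sub, map_mul, map_mul, mul_assoc, ← h.eq, ← mul_assoc, ← map_mul, Units.inv_mul,
        map_one, one_mul, sub_self]
    rw [hφ.mapMatrix h_zero hX, trace_zero, AddChar.map_zero_eq_one]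

theorem IsPrimitiveOver.exists_semiconjBy [Nonempty n] (hψ : IsPrimitiveOver φ ψ)
    {A : Matrix n n R} {u : GL n R}
    (hu : ∀ X, φ.mapMatrix X = 0 → trace X = 0 →
      ψ (trace (A * (u.1 * X * u⁻¹.1))) = ψ (trace (A * X))) :
    ∃ y, SemiconjBy (φ.mapMatrix u.1) (φ.mapMatrix A + φ y • 1) (φ.mapMatrix A) := by
  simp only [map_trace_conj_eq_iff] at hu
  obtain ⟨y, hy⟩ := hψ.exists_mapMatrix_eq_smul_one hu
  refine ⟨y, ?_⟩
  rw [← hy, ← map_add]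
  exact (semiconjBy_conj_sub A u).map φ.mapMatrix

namespace HasSquareZeroKernel

/-- Modulo the kernel, `M` and `M'` may be replaced one after the other by the commuting matrices
`P` and `P'`, since the other factor under the trace is the commutator of `B` with `M'` or `P'`. -/
theorem trace_mul_mul_sub_mul_eq_zero (hφ : HasSquareZeroKernel φ) {B M M' P P' : Matrix n n R}
    (hM : φ.mapMatrix M = φ.mapMatrix P) (hM' : φ.mapMatrix M' = φ.mapMatrix P')
    (hBM : Commute (φ.mapMatrix B) (φ.mapMatrix M))
    (hBM' : Commute (φ.mapMatrix B) (φ.mapMatrix M')) (hP : Commute P P') :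
    trace (B * (M * M' - M' * M)) = 0 := by
  have h_ker : φ.mapMatrix (B * M - M * B) = 0 := by
    rw [map_sub, map_mul, map_mul, hBM.eq, sub_self]
  have h_ker' : φ.mapMatrix (P' * B - B * P') = 0 := by
    rw [map_sub, map_mul, map_mul, ← hM', hBM'.eq, sub_self]
  calc trace (B * (M * M' - M' * M))
      = trace ((B * M - M * B) * M') := by
        rw [mul_sub, sub_mul, trace_sub, trace_sub, ← mul_assoc, ← mul_assoc,
          trace_mul_comm (B * M'), ← mul_assoc]
    _ = trace ((B * M - M * B) * P') := by rw [hφ.mapMatrix.mul_eq_mul_of_map_eq h_ker hM']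
    _ = trace ((P' * B - B * P') * M) := by
        rw [sub_mul, sub_mul, trace_sub, trace_sub, trace_mul_comm (B * M), ← mul_assoc,
          mul_assoc M, trace_mul_comm M]
    _ = trace ((P' * B - B * P') * P) := by rw [hφ.mapMatrix.mul_eq_mul_of_map_eq h_ker' hM]
    _ = trace (B * (P * P' - P' * P)) := by
        rw [sub_mul, mul_sub, trace_sub, trace_sub, mul_assoc, trace_mul_comm P']
        simp only [mul_assoc]
    _ = 0 := by rw [hP.eq, sub_self, mul_zero, trace_zero]

theorem trace_mul_commutatorElement_sub_one_eq_zero (hφ : HasSquareZeroKernel φ)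
    {A P P' : Matrix n n R} {u v : GL n R}
    (hu : φ.mapMatrix u.1 = φ.mapMatrix P) (hv : φ.mapMatrix v.1 = φ.mapMatrix P')
    (hP : Commute P P') (hAu : Commute (φ.mapMatrix A) (φ.mapMatrix u.1))
    (hAv : Commute (φ.mapMatrix A) (φ.mapMatrix v.1)) :
    trace (A * (⁅u, v⁆.1 - 1)) = 0 := by
  have huv : Commute (φ.mapMatrix u.1) (φ.mapMatrix v.1) := by
    rw [hu, hv]
    exact hP.map _
  have h_inv {w : GL n R} (hw : Commute (φ.mapMatrix w.1) (φ.mapMatrix u.1))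
      (hw' : Commute (φ.mapMatrix w.1) (φ.mapMatrix v.1)) :
      Commute (φ.mapMatrix w⁻¹.1) (φ.mapMatrix u.1) ∧
        Commute (φ.mapMatrix w⁻¹.1) (φ.mapMatrix v.1) :=
    ⟨Commute.units_inv_left (u := GeneralLinearGroup.map φ w) hw,
      Commute.units_inv_left (u := GeneralLinearGroup.map φ w) hw'⟩
  obtain ⟨huu, huv'⟩ := h_inv (w := u) (.refl _) huv
  obtain ⟨hvu, hvv⟩ := h_inv (w := v) huv.symm (.refl _)
  have h_comm : ⁅u, v⁆.1 - 1 =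
      (u.1 * v.1 - v.1 * u.1) * (u⁻¹.1 * v⁻¹.1) := by
    rw [sub_mul, commutatorElement_def]
    simp [mul_assoc]
  rw [h_comm, ← mul_assoc, trace_mul_comm, ← mul_assoc]
  refine hφ.trace_mul_mul_sub_mul_eq_zero hu hv ?_ ?_ hP
  · simpa only [map_mul] using (huu.mul_left hvu).mul_left hAu
  · simpa only [map_mul] using (huv'.mul_left hvv).mul_left hAv

end HasSquareZeroKernel

end MatrixCongruences

section CompanionTwo

open Matrix
open scoped commutatorElement MatrixGroups

variable {R : Type*} [CommRing R] {t d x p q : R}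

/-- The companion matrix of `X² - t X + d`. Every cyclic `2 × 2` matrix with trace `t` and
determinant `d` is similar to it. -/
def companionTwo (t d : R) : Matrix (Fin 2) (Fin 2) R :=
  !![0, -d; 1, t]

/-- The upper unitriangular matrix with entry `x`. -/
abbrev upperTransvection (x : R) : SL(2, R) :=
  Matrix.SpecialLinearGroup.transvection zero_ne_one x

theorem coe_upperTransvection (x : R) :
    (upperTransvection x : Matrix (Fin 2) (Fin 2) R) = !![1, x; 0, 1] := by
  ext i j
  fin_cases i <;> fin_cases j <;> simp [Matrix.SpecialLinearGroup.transvection_coe]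

theorem map_upperTransvection {R' : Type*} [CommRing R'] (φ : R →+* R') (x : R) :
    Matrix.SpecialLinearGroup.map φ (upperTransvection x) = upperTransvection (φ x) := by
  ext i j
  fin_cases i <;> fin_cases j <;> simp [coe_upperTransvection]

theorem mapMatrix_companionTwo {R' : Type*} [CommRing R'] (φ : R →+* R') (t d : R) :
    φ.mapMatrix (companionTwo t d) = companionTwo (φ t) (φ d) := by
  ext i j
  fin_cases i <;> fin_cases j <;> simp [companionTwo]

theorem smul_one_add_smul_companionTwo (t d p q : R) :
    p • 1 + q • companionTwo t d = !![p, -(d * q); q, p + t * q] := by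
  ext i j
  fin_cases i <;> fin_cases j <;> simp [companionTwo, mul_comm]

theorem companionTwo_add_smul_one (t d x : R) :
    companionTwo t d + x • 1 = !![x, -d; 1, t + x] := by
  ext i j
  fin_cases i <;> fin_cases j <;> simp [companionTwo]

theorem commute_smul_one_add_smul_companionTwo (t d p q : R) :
    Commute (p • 1 + q • companionTwo t d) (companionTwo t d) :=
  ((Commute.one_left _).smul_left _).add_left ((Commute.refl _).smul_left _)

theorem commute_companionTwo_iff {M : Matrix (Fin 2) (Fin 2) R} :
    Commute M (companionTwo t d) ↔ M = M 0 0 • 1 + M 1 0 • companionTwo t d := by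
  constructor
  · intro h
    have h₀ := congrFun₂ h.eq 0 0
    have h₁ := congrFun₂ h.eq 1 0
    simp only [companionTwo, Fin.isValue, mul_apply, of_apply, cons_val', cons_val_zero,
      cons_val_fin_one, Fin.sum_univ_two, mul_zero, cons_val_one, mul_one, zero_add, zero_mul,
      neg_mul, one_mul] at h₀ h₁
    rw [smul_one_add_smul_companionTwo]
    ext i j
    fin_cases i <;> fin_cases j <;> simp [h₀, h₁]
  · intro h
    rw [h]
    exact commute_smul_one_add_smul_companionTwo ..

theorem commute_of_commute_companionTwo {M M' : Matrix (Fin 2) (Fin 2) R}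
    (hM : Commute M (companionTwo t d)) (hM' : Commute M' (companionTwo t d)) :
    Commute M M' := by
  rw [commute_companionTwo_iff.1 hM']
  exact ((Commute.one_right _).smul_right _).add_right (hM.smul_right _)

theorem normForm_eq_one_of_commute_companionTwo {M : SL(2, R)}
    (hM : Commute (M : Matrix (Fin 2) (Fin 2) R) (companionTwo t d)) :
    normForm t d (M 0 0) (M 1 0) = 1 := by
  have h_det := M.det_coe
  rw [commute_companionTwo_iff.1 hM, smul_one_add_smul_companionTwo, det_fin_two_of] at h_det
  rw [normForm]
  linear_combination h_det

theorem eq_zero_of_semiconjBy_companionTwo {u : GL (Fin 2) R}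
    (hu : SemiconjBy u.1 (companionTwo t d + x • 1) (companionTwo t d)) :
    2 * x = 0 ∧ x ^ 2 + t * x = 0 := by
  have h_conj : u.1 * (companionTwo t d + x • 1) * u⁻¹.1 = companionTwo t d := by
    rw [hu.eq, mul_assoc, Units.mul_inv, mul_one]
  have h_trace := trace_units_conj u (companionTwo t d + x • 1)
  have h_det := det_units_conj u (companionTwo t d + x • 1)
  rw [h_conj, companionTwo_add_smul_one, companionTwo] at h_trace h_det
  rw [trace_fin_two_of, trace_fin_two_of] at h_trace
  rw [det_fin_two_of, det_fin_two_of] at h_det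
  exact ⟨by linear_combination -h_trace, by linear_combination -h_det⟩

theorem semiconjBy_upperTransvection (hx : 2 * x = 0) (hx' : x ^ 2 + t * x = 0) :
    SemiconjBy (upperTransvection x : Matrix (Fin 2) (Fin 2) R)
      (companionTwo t d + x • 1) (companionTwo t d) := by
  rw [SemiconjBy, coe_upperTransvection, companionTwo_add_smul_one, companionTwo, mul_fin_two,
    mul_fin_two]
  simp only [EmbeddingLike.apply_eq_iff_eq, vecCons_inj, and_true]
  exact ⟨⟨by linear_combination hx, by linear_combination hx'⟩, by ring, by ring⟩

theorem commute_upperTransvection_iff :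
    Commute (upperTransvection x : Matrix (Fin 2) (Fin 2) R) (p • 1 + q • companionTwo t d) ↔
      x * q = 0 := by
  rw [commute_iff_eq, coe_upperTransvection, smul_one_add_smul_companionTwo, mul_fin_two,
    mul_fin_two]
  constructor
  · intro h
    simpa using congrFun₂ h 0 0
  · intro h
    simp only [EmbeddingLike.apply_eq_iff_eq, vecCons_inj, and_true]
    exact ⟨⟨by linear_combination h, by linear_combination t * h⟩, by ring,
      by linear_combination -h⟩

theorem trace_companionTwo_mul_commutatorElement (t d x : R) (M : SL(2, R)) :
    trace (companionTwo t d * (⁅upperTransvection x, M⁆ - 1 : Matrix (Fin 2) (Fin 2) R)) =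
      x * M 0 0 * (M 1 1 - M 0 0 - t * M 1 0 - x * M 1 0) -
        x * M 1 0 * (M 0 1 + d * M 1 0) := by
  have h_det := M.det_coe
  rw [det_fin_two] at h_det
  rw [commutatorElement_def, Matrix.SpecialLinearGroup.transvection_inv]
  simp only [Matrix.SpecialLinearGroup.coe_mul, coe_upperTransvection]
  rw [Matrix.SpecialLinearGroup.coe_inv, adjugate_fin_two, eta_fin_two (M : Matrix _ _ R),
    companionTwo, mul_fin_two, mul_fin_two, mul_fin_two, one_fin_two, trace_fin_two]
  simp only [one_mul, mul_one, mul_zero, add_zero, of_apply, cons_val', cons_val_one,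
    cons_val_fin_one, mul_neg, cons_val_zero, zero_mul, zero_add, sub_zero, Matrix.sub_apply,
    mul_apply, Fin.sum_univ_two, neg_mul]
  linear_combination t * h_det

theorem mapMatrix_eq_of_commute_companionTwo {R' : Type*} [CommRing R'] {φ : R →+* R'}
    {M : Matrix (Fin 2) (Fin 2) R}
    (hM : Commute (φ.mapMatrix M) (companionTwo (φ t) (φ d))) :
    φ.mapMatrix M = φ.mapMatrix (M 0 0 • 1 + M 1 0 • companionTwo t d) := by
  rw [commute_companionTwo_iff.1 hM, smul_one_add_smul_companionTwo,
    smul_one_add_smul_companionTwo]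
  ext i j
  fin_cases i <;> fin_cases j <;> simp

end CompanionTwo

section CompanionModel

open Matrix
open scoped commutatorElement MatrixGroups

variable {R R' : Type*} [CommRing R] [CommRing R'] {φ : R →+* R'} {ψ : AddChar R ℂˣ} {t d : R}
  {G : Type*} [Group G] {K C : Subgroup G} {χ : K →* ℂˣ} {c : G ≃* SL(2, R)}

/-- The isomorphism `c` identifies `K` with the congruence subgroup of `SL₂(R)`, `χ` with the
character `ψ_{[A]}` and `C` with the stabilizer of `ψ_A`, where `A` is the companion matrix. For a
cyclic matrix, `c` is the conjugation that brings it into companion form. -/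
structure IsCompanionModel (φ : R →+* R') (ψ : AddChar R ℂˣ) (t d : R) (c : G ≃* SL(2, R))
    (χ : K →* ℂˣ) (C : Subgroup G) : Prop where
  mem_iff : ∀ g, g ∈ K ↔ Matrix.SpecialLinearGroup.map φ (c g) = 1
  apply_eq : ∀ k : K,
    χ k = ψ (trace (companionTwo t d * ((c k : Matrix (Fin 2) (Fin 2) R) - 1)))
  mem_stabilizer_iff : ∀ g, g ∈ C ↔
    Commute (φ.mapMatrix (c g : Matrix (Fin 2) (Fin 2) R)) (companionTwo (φ t) (φ d))

theorem map_coe_commutatorElement {H : Type*} [Group H] (f : G ≃* H) {S : Subgroup G} (a b : S) :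
    f (⁅a, b⁆ : S) = ⁅f a, f b⁆ :=
  map_commutatorElement (f.toMonoidHom.comp S.subtype) a b

theorem det_one_add_eq_one (hφ : HasSquareZeroKernel φ) {X : Matrix (Fin 2) (Fin 2) R}
    (hX : φ.mapMatrix X = 0) (hX' : trace X = 0) : det (1 + X) = 1 := by
  rw [trace_fin_two] at hX'
  rw [det_fin_two]
  simp only [Matrix.add_apply, one_apply_eq, one_apply_ne, ne_eq, zero_ne_one, one_ne_zero,
    not_false_eq_true]
  linear_combination hX' + hφ (congrFun₂ hX 0 0) (congrFun₂ hX 1 1) -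
    hφ (congrFun₂ hX 0 1) (congrFun₂ hX 1 0)

/-- The elements of the stabilizer of `χ` that are unitriangular in the model, with an entry `x`
such that the companion matrices `A` and `A + x` are similar over the image of `φ`. -/
def companionTransversal [K.Normal] (φ : R →+* R') (t : R) (c : G ≃* SL(2, R)) (χ : K →* ℂˣ) :
    Set (inertiaGroup χ) :=
  {e | ∃ x, φ (2 * x) = 0 ∧ φ (x ^ 2 + t * x) = 0 ∧ c e = upperTransvection x}

namespace IsCompanionModel

theorem mapMatrix_sub_one_eq_zero (h : IsCompanionModel φ ψ t d c χ C) (k : K) :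
    φ.mapMatrix ((c k : Matrix (Fin 2) (Fin 2) R) - 1) = 0 := by
  have h_one := congrArg ((↑) : SL(2, R') → Matrix (Fin 2) (Fin 2) R') ((h.mem_iff k).1 k.2)
  rw [Matrix.SpecialLinearGroup.map_apply_coe, Matrix.SpecialLinearGroup.coe_one] at h_one
  rw [map_sub, h_one, map_one, sub_self]

theorem commutatorElement_mem_iff (h : IsCompanionModel φ ψ t d c χ C) {a b : G} :
    ⁅a, b⁆ ∈ K ↔ Commute (φ.mapMatrix (c a : Matrix (Fin 2) (Fin 2) R))
      (φ.mapMatrix (c b : Matrix (Fin 2) (Fin 2) R)) := by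
  rw [h.mem_iff, map_commutatorElement, map_commutatorElement,
    commutatorElement_eq_one_iff_commute]
  exact Subtype.ext_iff

variable [K.Normal]

theorem apply_conjNormal (h : IsCompanionModel φ ψ t d c χ C) (g : G) (k : K) :
    χ (MulAut.conjNormal g k) = ψ (trace (companionTwo t d *
      ((c g).toGL.1 * ((c k : Matrix (Fin 2) (Fin 2) R) - 1) * (c g).toGL⁻¹.1))) := by
  rw [h.apply_eq, MulAut.conjNormal_apply, mul_sub (c g).toGL.1, sub_mul, mul_one,
    Units.mul_inv]
  simp only [map_mul, map_inv]
  rfl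

theorem le_inertiaGroup (h : IsCompanionModel φ ψ t d c χ C) (hφ : HasSquareZeroKernel φ)
    (hψ : IsPrimitiveOver φ ψ) : C ≤ inertiaGroup χ := by
  intro g hg k
  rw [h.apply_conjNormal, h.apply_eq]
  refine (hψ.forall_map_trace_conj_eq_iff hφ).2 ?_ _ (h.mapMatrix_sub_one_eq_zero k)
  rw [mapMatrix_companionTwo]
  exact (h.mem_stabilizer_iff g).1 hg

theorem exists_semiconjBy (h : IsCompanionModel φ ψ t d c χ C) (hφ : HasSquareZeroKernel φ)
    (hψ : IsPrimitiveOver φ ψ) {g : G} (hg : g ∈ inertiaGroup χ) :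
    ∃ y, SemiconjBy (φ.mapMatrix (c g : Matrix (Fin 2) (Fin 2) R))
      (companionTwo (φ t) (φ d) + φ y • 1) (companionTwo (φ t) (φ d)) := by
  rw [← mapMatrix_companionTwo]
  refine hψ.exists_semiconjBy (u := (c g).toGL) fun X hX hX' => ?_
  obtain ⟨k, hk⟩ : ∃ k, (c k : Matrix (Fin 2) (Fin 2) R) = 1 + X :=
    ⟨c.symm ⟨_, det_one_add_eq_one hφ hX hX'⟩, congrArg _ (c.apply_symm_apply _)⟩
  have hkK : k ∈ K := by
    refine (h.mem_iff k).2 (Subtype.ext ?_)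
    rw [Matrix.SpecialLinearGroup.map_apply_coe, hk, map_add, hX, map_one, add_zero,
      Matrix.SpecialLinearGroup.coe_one]
  have h_conj := hg ⟨k, hkK⟩
  rwa [h.apply_conjNormal, h.apply_eq, hk, add_sub_cancel_left] at h_conj

theorem normal_subgroupOf (h : IsCompanionModel φ ψ t d c χ C) (hφ : HasSquareZeroKernel φ)
    (hψ : IsPrimitiveOver φ ψ) : (C.subgroupOf (inertiaGroup χ)).Normal := by
  refine ⟨fun n hn g => ?_⟩
  rw [Subgroup.mem_subgroupOf, h.mem_stabilizer_iff] at hn ⊢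
  obtain ⟨y, hy⟩ := h.exists_semiconjBy hφ hψ g.2
  have h_inv := SemiconjBy.units_inv_symm_left (a := GeneralLinearGroup.map φ (c g).toGL) hy
  have h_mul := (hy.mul_left (hn.add_right ((Commute.one_right _).smul_right _))).mul_left h_inv
  simp only [Subgroup.coe_mul, Subgroup.coe_inv, map_mul, map_inv,
    Matrix.SpecialLinearGroup.coe_mul]
  exact h_mul

theorem isAbelianOver (h : IsCompanionModel φ ψ t d c χ C) (hφ : HasSquareZeroKernel φ) :
    IsAbelianOver χ (C.subgroupOf (inertiaGroup χ)) where
  le := by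
    intro k hk
    rw [Subgroup.mem_subgroupOf] at hk ⊢
    rw [h.mem_stabilizer_iff, ← Matrix.SpecialLinearGroup.map_apply_coe, (h.mem_iff _).1 hk]
    exact Commute.one_left _
  commutator := by
    intro a ha b hb
    rw [Subgroup.mem_subgroupOf, h.mem_stabilizer_iff] at ha hb
    refine ⟨h.commutatorElement_mem_iff.2 (commute_of_commute_companionTwo ha hb), ?_⟩
    simp only [h.apply_eq, map_coe_commutatorElement]
    have h_trace := hφ.trace_mul_commutatorElement_sub_one_eq_zero (A := companionTwo t d)
      (u := (c a).toGL) (v := (c b).toGL) (mapMatrix_eq_of_commute_companionTwo ha)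
      (mapMatrix_eq_of_commute_companionTwo hb) ?_ ?_ ?_
    · rw [← map_commutatorElement] at h_trace
      exact (congrArg ψ h_trace).trans ψ.map_zero_eq_one
    · exact commute_of_commute_companionTwo (commute_smul_one_add_smul_companionTwo ..)
        (commute_smul_one_add_smul_companionTwo ..)
    · rw [mapMatrix_companionTwo]
      exact ha.symm
    · rw [mapMatrix_companionTwo]
      exact hb.symm

theorem isTransversalOver (h : IsCompanionModel φ ψ t d c χ C) (hφ : HasSquareZeroKernel φ)
    (hψ : IsPrimitiveOver φ ψ) :
    IsTransversalOver χ (C.subgroupOf (inertiaGroup χ)) (companionTransversal φ t c χ) where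
  exists_mul := by
    intro g
    obtain ⟨y, hy⟩ := h.exists_semiconjBy hφ hψ g.2
    obtain ⟨hy₁, hy₂⟩ := eq_zero_of_semiconjBy_companionTwo
      (u := GeneralLinearGroup.map φ (c g).toGL) hy
    have h_semiconj := semiconjBy_upperTransvection (d := φ d) hy₁ hy₂
    have h_inv := SemiconjBy.units_inv_symm_left (a := (upperTransvection (φ y)).toGL) h_semiconj
    have hn : (g : G) * (c.symm (upperTransvection y))⁻¹ ∈ C := by
      rw [h.mem_stabilizer_iff, map_mul, map_inv, c.apply_symm_apply,
        Matrix.SpecialLinearGroup.coe_mul, map_mul,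
        ← Matrix.SpecialLinearGroup.map_apply_coe φ _⁻¹, map_inv, map_upperTransvection]
      exact hy.mul_left h_inv
    obtain ⟨n, hn_eq⟩ : ∃ n : inertiaGroup χ, (n : G) = g * (c.symm (upperTransvection y))⁻¹ :=
      ⟨⟨_, h.le_inertiaGroup hφ hψ hn⟩, rfl⟩
    refine ⟨n, ?_, n⁻¹ * g, ⟨y, ?_, ?_, ?_⟩, (mul_inv_cancel_left n g).symm⟩
    · rwa [Subgroup.mem_subgroupOf, hn_eq]
    · rw [map_mul, map_ofNat, hy₁]
    · rw [map_add, map_pow, map_mul, hy₂]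
    · rw [Subgroup.coe_mul, Subgroup.coe_inv, hn_eq, _root_.mul_inv_rev, inv_inv,
        inv_mul_cancel_right, c.apply_symm_apply]
  commute := by
    rintro e ⟨x, -, -, hx⟩ e' ⟨y, -, -, hy⟩
    refine Subtype.ext (c.injective ?_)
    simp only [Subgroup.coe_mul, map_mul, hx, hy]
    rw [← Matrix.SpecialLinearGroup.transvection_add, add_comm,
      Matrix.SpecialLinearGroup.transvection_add]
  sq_mem := by
    rintro e ⟨x, hx, -, hex⟩
    rw [h.mem_iff, Subgroup.coe_pow, map_pow, hex, pow_two,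
      ← Matrix.SpecialLinearGroup.transvection_add, ← two_mul, map_upperTransvection, hx]
    exact Matrix.SpecialLinearGroup.transvection_coeff_zero _

/-- The commutators are evaluated at the stabilizing matrix with first column `p`, `q`, whose
remaining diagonal entry is corrected to make the determinant one. -/
theorem isTrivialOnNormOne (h : IsCompanionModel φ ψ t d c χ C) (hφ : HasSquareZeroKernel φ)
    (hψ : IsPrimitiveOver φ ψ) {e : inertiaGroup χ} {x : R} (he : c e = upperTransvection x)
    (h_triv : IsTrivialOnCommutators χ (C.subgroupOf (inertiaGroup χ)) e) :
    IsTrivialOnNormOne φ ψ t d x := by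
  rintro p q ⟨p, rfl⟩ hpq hxq
  set δ : R := ↑p⁻¹ * (1 - normForm t d p q)
  have hδ : φ δ = 0 := by rw [map_mul, map_sub, hpq, map_one, sub_self, mul_zero]
  have hpδ : p * δ = 1 - normForm t d p q := p.mul_inv_cancel_left _
  obtain ⟨g, hg⟩ : ∃ g,
      (c g : Matrix (Fin 2) (Fin 2) R) = !![(p : R), -(d * q); q, p + t * q + δ] := by
    refine ⟨c.symm ⟨_, ?_⟩, congrArg _ (c.apply_symm_apply _)⟩
    rw [det_fin_two_of]
    rw [normForm] at hpδ
    linear_combination hpδ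
  have h_map : φ.mapMatrix (c g : Matrix (Fin 2) (Fin 2) R) =
      φ (p : R) • 1 + φ q • companionTwo (φ t) (φ d) := by
    rw [hg, smul_one_add_smul_companionTwo]
    ext i j
    fin_cases i <;> fin_cases j <;> simp [hδ]
  have hgC : g ∈ C := by
    rw [h.mem_stabilizer_iff, h_map]
    exact commute_smul_one_add_smul_companionTwo ..
  have h_mem : ⁅(e : G), g⁆ ∈ K := by
    rw [h.commutatorElement_mem_iff, he, ← Matrix.SpecialLinearGroup.map_apply_coe,
      map_upperTransvection, h_map, commute_upperTransvection_iff, ← map_mul, hxq]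
  have h_one := h_triv ⟨g, h.le_inertiaGroup hφ hψ hgC⟩ hgC h_mem
  simp only [h.apply_eq, map_coe_commutatorElement, he] at h_one
  rw [trace_companionTwo_mul_commutatorElement, hg] at h_one
  rw [← h_one]
  congr 1
  simp only [of_apply, cons_val', cons_val_zero, cons_val_fin_one, cons_val_one, neg_add_cancel,
    mul_zero, sub_zero]
  linear_combination -x * hpδ

theorem inv_mul_mem_of_isTrivialOnCommutators (h : IsCompanionModel φ ψ t d c χ C)
    (hφ : HasSquareZeroKernel φ) (hψ : IsPrimitiveOver φ ψ) {e e' n : inertiaGroup χ}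
    (he : e ∈ companionTransversal φ t c χ) (he' : e' ∈ companionTransversal φ t c χ)
    (h_triv : IsTrivialOnCommutators χ (C.subgroupOf (inertiaGroup χ)) e)
    (h_triv' : IsTrivialOnCommutators χ (C.subgroupOf (inertiaGroup χ)) e')
    (h_notMem : e' ∉ C.subgroupOf (inertiaGroup χ)) (hn : n ∈ C.subgroupOf (inertiaGroup χ))
    (hen : ((⁅e, n⁆ : inertiaGroup χ) : G) ∉ K) :
    e⁻¹ * e' ∈ C.subgroupOf (inertiaGroup χ) := by
  obtain ⟨x, -, -, hex⟩ := he
  obtain ⟨y, hy, -, hey⟩ := he'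
  rw [Subgroup.mem_subgroupOf, h.mem_stabilizer_iff] at hn
  have h_form := normForm_eq_one_of_commute_companionTwo
    (M := Matrix.SpecialLinearGroup.map φ (c n)) hn
  have hy0 : φ y ≠ 0 := by
    refine fun h0 => h_notMem ((h.isAbelianOver hφ).le ?_)
    rw [Subgroup.mem_subgroupOf, h.mem_iff, hey, map_upperTransvection, h0]
    exact Matrix.SpecialLinearGroup.transvection_coeff_zero _
  have hxq : φ (c n 1 0 * x) ≠ 0 := by
    intro h0
    refine hen (h.commutatorElement_mem_iff.2 ?_)
    rw [hex, ← Matrix.SpecialLinearGroup.map_apply_coe, map_upperTransvection,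
      commute_companionTwo_iff.1 hn, commute_upperTransvection_iff, mul_comm]
    exact (map_mul φ _ _).symm.trans h0
  have hxy : φ x = φ y := (h.isTrivialOnNormOne hφ hψ hex h_triv).map_eq_map hφ hψ
    (h.isTrivialOnNormOne hφ hψ hey h_triv') hy0 hy ((map_normForm ..).trans h_form) hxq
  refine (h.isAbelianOver hφ).le ?_
  rw [Subgroup.mem_subgroupOf, h.mem_iff, Subgroup.coe_mul, Subgroup.coe_inv, map_mul, map_mul,
    map_inv, map_inv, hex, hey, map_upperTransvection, map_upperTransvection, hxy,
    inv_mul_cancel]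

theorem existsUnique_isCliffordSubgroup [Finite G] (h : IsCompanionModel φ ψ t d c χ C)
    (hφ : HasSquareZeroKernel φ) (hψ : IsPrimitiveOver φ ψ) :
    (∃! M, IsCliffordSubgroup C χ M) ∧
      ∀ (M : Subgroup (inertiaGroup χ)) [M.Normal],
        IsCliffordSubgroup C χ M → InductionBijective χ M := by
  have := h.normal_subgroupOf hφ hψ
  refine (h.isTransversalOver hφ hψ).existsUnique_isCliffordSubgroup (h.isAbelianOver hφ)
    (h.le_inertiaGroup hφ hψ) rfl ?_
  rintro e he e' he' h_triv h_triv' h_notMem ⟨n, hn, hen⟩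
  exact h.inv_mul_mem_of_isTrivialOnCommutators hφ hψ he he' h_triv h_triv' h_notMem hn hen

end IsCompanionModel

end CompanionModel

section CyclicMatrices

open Matrix
open scoped MatrixGroups

theorem HasSquareZeroKernel.exists_units_map_eq {R R' : Type*} [Ring R] [Ring R'] {φ : R →+* R'}
    (hφ : HasSquareZeroKernel φ) (h_surj : Function.Surjective φ) (u : R'ˣ) :
    ∃ v : Rˣ, φ v = u := by
  obtain ⟨a, ha⟩ := h_surj u
  obtain ⟨v, rfl⟩ := hφ.isUnit_of_map h_surj (ha ▸ u.isUnit)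
  exact ⟨v, ha⟩

theorem commute_units_inv_mul_mul_iff {S : Type*} [Monoid S] {u : Sˣ} {a b g : S}
    (h : SemiconjBy ↑u a b) : Commute (↑u⁻¹ * g * ↑u) a ↔ Commute g b := by
  have h_inv : SemiconjBy ↑u⁻¹ b a := h.units_inv_symm_left
  constructor
  · intro hg
    have h_conj := (h.mul_left hg).mul_left h_inv
    rwa [mul_assoc ↑u⁻¹ g, Units.mul_inv_cancel_left, Units.mul_inv_cancel_right] at h_conj
  · exact fun hg => (h_inv.mul_left hg).mul_left h

variable {R R' : Type*} [CommRing R] [CommRing R'] {φ : R →+* R'} {n : Type*} [Fintype n]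
  [DecidableEq n]

theorem HasSquareZeroKernel.trace_mul_eq_of_mapMatrix_eq (hφ : HasSquareZeroKernel φ)
    {A B X : Matrix n n R} (hX : φ.mapMatrix X = 0) (hAB : φ.mapMatrix A = φ.mapMatrix B) :
    trace (A * X) = trace (B * X) := by
  rw [trace_mul_comm A, trace_mul_comm B, hφ.mapMatrix.mul_eq_mul_of_map_eq hX hAB]

/-- The automorphism `g ↦ P⁻¹ g P` of the special linear group. -/
def conjSL (P : GL n R) : Matrix.SpecialLinearGroup n R ≃* Matrix.SpecialLinearGroup n R where
  toFun g := ⟨P⁻¹.1 * g * P.1, by rw [det_units_conj', g.det_coe]⟩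
  invFun g := ⟨P.1 * g * P⁻¹.1, by rw [det_units_conj, g.det_coe]⟩
  left_inv g := Subtype.ext (by simp [mul_assoc])
  right_inv g := Subtype.ext (by simp [mul_assoc])
  map_mul' g h := Subtype.ext (by
    refine Eq.trans ?_ (Matrix.SpecialLinearGroup.coe_mul _ _).symm
    simp [mul_assoc])

theorem coe_conjSL (P : GL n R) (g : Matrix.SpecialLinearGroup n R) :
    (conjSL P g : Matrix n n R) = P⁻¹.1 * g * P.1 :=
  rfl

theorem map_conjSL (φ : R →+* R') (P : GL n R) (g : Matrix.SpecialLinearGroup n R) :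
    Matrix.SpecialLinearGroup.map φ (conjSL P g) =
      conjSL (GeneralLinearGroup.map φ P) (Matrix.SpecialLinearGroup.map φ g) :=
  Subtype.ext (by
    rw [Matrix.SpecialLinearGroup.map_apply_coe, coe_conjSL, map_mul, map_mul]
    rfl)

/-- The columns of the conjugating matrix are `v` and `A v`, for a cyclic vector `v`. -/
theorem IsCyclicMatrix.exists_semiconjBy {A : Matrix (Fin 2) (Fin 2) R} (hA : IsCyclicMatrix A) :
    ∃ P : GL (Fin 2) R, SemiconjBy P.1 (companionTwo A.trace A.det) A := by
  obtain ⟨v, hv⟩ := hA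
  have h_unit : IsUnit !![v 0, A.mulVec v 0; v 1, A.mulVec v 1] := by
    rw [← mulVec_surjective_iff_isUnit]
    intro w
    obtain ⟨a, b, h⟩ := Submodule.mem_span_pair.1 (hv ▸ Submodule.mem_top : w ∈ _)
    refine ⟨![a, b], ?_⟩
    rw [← h]
    ext i
    fin_cases i <;> simp [mulVec, dotProduct, Fin.sum_univ_two] <;> ring
  obtain ⟨P, hP⟩ := h_unit
  refine ⟨P, ?_⟩
  rw [SemiconjBy, hP]
  obtain ⟨p, q, r, s, rfl⟩ : ∃ p q r s, A = !![p, q; r, s] := ⟨_, _, _, _, eta_fin_two _⟩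
  ext i j
  fin_cases i <;> fin_cases j <;>
    simp [companionTwo, mulVec, dotProduct, Fin.sum_univ_two, trace_fin_two, det_fin_two,
      mul_apply] <;> ring

end CyclicMatrices

section CongruenceSubgroups

open Matrix
open scoped MatrixGroups

variable {𝒪 : Type*} [CommRing 𝒪] [IsLocalRing 𝒪] {ℓ : ℕ}
  {ψ : AddChar (TruncRing 𝒪 (2 * ℓ)) ℂˣ} {A : Matrix (Fin 2) (Fin 2) (TruncRing 𝒪 ℓ)}

theorem mapMatrix_liftMatrix (A : Matrix (Fin 2) (Fin 2) (TruncRing 𝒪 ℓ)) :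
    (truncMap 𝒪 ℓ).mapMatrix (liftMatrix A) = A := by
  ext i j
  exact Function.surjInv_eq (truncMap_surjective ℓ) _

theorem truncMap_trace_liftMatrix (A : Matrix (Fin 2) (Fin 2) (TruncRing 𝒪 ℓ)) :
    truncMap 𝒪 ℓ (liftMatrix A).trace = A.trace := by
  rw [AddMonoidHom.map_trace]
  exact congrArg trace (mapMatrix_liftMatrix A)

theorem truncMap_det_liftMatrix (A : Matrix (Fin 2) (Fin 2) (TruncRing 𝒪 ℓ)) :
    truncMap 𝒪 ℓ (liftMatrix A).det = A.det := by
  rw [RingHom.map_det, mapMatrix_liftMatrix]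

theorem mem_congSL_iff {g : SL(2, TruncRing 𝒪 (2 * ℓ))} :
    g ∈ congSL 𝒪 ℓ ↔ Matrix.SpecialLinearGroup.map (truncMap 𝒪 ℓ) g = 1 :=
  ⟨fun h => Subtype.ext (congrArg Units.val h),
    fun h => Units.ext (congrArg Subtype.val h)⟩

theorem mapMatrix_congGL_sub_one (k : congGL 𝒪 ℓ) :
    (truncMap 𝒪 ℓ).mapMatrix (k.1.1 - 1) = 0 := by
  ext i j
  exact congGL_sub_one k i j

theorem exists_congGL_sub_one_eq {X : Matrix (Fin 2) (Fin 2) (TruncRing 𝒪 (2 * ℓ))}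
    (hX : (truncMap 𝒪 ℓ).mapMatrix X = 0) : ∃ k : congGL 𝒪 ℓ, k.1.1 - 1 = X := by
  have h_map : (truncMap 𝒪 ℓ).mapMatrix (1 + X) = 1 := by rw [map_add, map_one, hX, add_zero]
  obtain ⟨u, hu⟩ := hasSquareZeroKernel_truncMap.mapMatrix.isUnit_of_map_eq_one h_map
  refine ⟨⟨u, Units.ext ?_⟩, by rw [hu, add_sub_cancel_left]⟩
  rw [← hu] at h_map
  exact h_map

theorem psiA_conjNormal (ψ : AddChar (TruncRing 𝒪 (2 * ℓ)) ℂˣ)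
    (A : Matrix (Fin 2) (Fin 2) (TruncRing 𝒪 ℓ)) (u : GL (Fin 2) (TruncRing 𝒪 (2 * ℓ)))
    (k : congGL 𝒪 ℓ) :
    psiA ψ A (MulAut.conjNormal u k) =
      ψ (trace (liftMatrix A * (u.1 * (k.1.1 - 1) * u⁻¹.1))) := by
  rw [mul_sub u.1, sub_mul, mul_one, Units.mul_inv]
  rfl

theorem mem_stabSL_iff (hψ : IsPrimitiveOver (truncMap 𝒪 ℓ) ψ)
    {g : SL(2, TruncRing 𝒪 (2 * ℓ))} :
    g ∈ stabSL ψ A ↔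
      Commute ((truncMap 𝒪 ℓ).mapMatrix (g : Matrix (Fin 2) (Fin 2) (TruncRing 𝒪 (2 * ℓ)))) A := by
  have h_comm := hψ.forall_map_trace_conj_eq_iff hasSquareZeroKernel_truncMap
    (A := liftMatrix A) (u := g.toGL)
  rw [mapMatrix_liftMatrix] at h_comm
  refine Iff.trans ⟨fun hg X hX => ?_, fun hg k => ?_⟩ h_comm
  · obtain ⟨k, rfl⟩ := exists_congGL_sub_one_eq hX
    exact (psiA_conjNormal ψ A _ k).symm.trans (hg k)
  · exact (psiA_conjNormal ψ A _ k).trans (hg _ (mapMatrix_congGL_sub_one k))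

theorem isCompanionModel_conjSL (hψ : IsPrimitiveOver (truncMap 𝒪 ℓ) ψ)
    {P : GL (Fin 2) (TruncRing 𝒪 (2 * ℓ))}
    (hP : SemiconjBy ((truncMap 𝒪 ℓ).mapMatrix P.1) (companionTwo A.trace A.det) A) :
    IsCompanionModel (truncMap 𝒪 ℓ) ψ (liftMatrix A).trace (liftMatrix A).det (conjSL P)
      (psiBracket ψ A) (stabSL ψ A) where
  mem_iff g := by rw [mem_congSL_iff, map_conjSL, MulEquiv.map_eq_one_iff]
  apply_eq k := by
    set C := companionTwo (liftMatrix A).trace (liftMatrix A).det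
    set X : Matrix (Fin 2) (Fin 2) (TruncRing 𝒪 (2 * ℓ)) := k - 1
    have hX : (truncMap 𝒪 ℓ).mapMatrix X = 0 :=
      mapMatrix_congGL_sub_one (Matrix.SpecialLinearGroup.toGL.subgroupComap (congGL 𝒪 ℓ) k)
    have hC : (truncMap 𝒪 ℓ).mapMatrix (P.1 * C * P⁻¹.1) =
        (truncMap 𝒪 ℓ).mapMatrix (liftMatrix A) := by
      rw [map_mul, map_mul, mapMatrix_companionTwo, truncMap_trace_liftMatrix,
        truncMap_det_liftMatrix, hP.eq, mul_assoc, ← map_mul, Units.mul_inv, map_one, mul_one,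
        mapMatrix_liftMatrix]
    refine congrArg ψ ?_
    calc trace (liftMatrix A * X)
        = trace (P.1 * C * P⁻¹.1 * X) :=
          (hasSquareZeroKernel_truncMap.trace_mul_eq_of_mapMatrix_eq hX hC).symm
      _ = trace (C * (P⁻¹.1 * X * P.1)) := by
          rw [mul_assoc, mul_assoc, trace_mul_comm P.1]
          simp only [mul_assoc]
      _ = trace (C * ((conjSL P k : Matrix (Fin 2) (Fin 2) (TruncRing 𝒪 (2 * ℓ))) - 1)) := by
          rw [coe_conjSL, mul_sub P⁻¹.1, sub_mul, mul_one, Units.inv_mul]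
  mem_stabilizer_iff g := by
    rw [mem_stabSL_iff hψ, truncMap_trace_liftMatrix, truncMap_det_liftMatrix, coe_conjSL,
      map_mul, map_mul]
    exact (commute_units_inv_mul_mul_iff (u := GeneralLinearGroup.map (truncMap 𝒪 ℓ) P) hP).symm

end CongruenceSubgroups

end

theorem mainTheorem4_general {𝒪 : Type*} [CommRing 𝒪] [IsDomain 𝒪] [IsDiscreteValuationRing 𝒪]
    [Finite (IsLocalRing.ResidueField 𝒪)] (ℓ : ℕ) (ϖ : 𝒪) (hϖ : Irreducible ϖ)
    (ψ : AddChar (TruncRing 𝒪 (2 * ℓ)) ℂˣ)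
    (hψ : ψ (Ideal.Quotient.mk _ (ϖ ^ (2 * ℓ - 1))) ≠ 1)
    (A : Matrix (Fin 2) (Fin 2) (TruncRing 𝒪 ℓ)) (hA : IsCyclicMatrix A) :
    (∃! M : Subgroup (inertiaGroup (psiBracket ψ A)),
      IsCliffordSubgroup (stabSL ψ A) (psiBracket ψ A) M) ∧
    ∀ (M : Subgroup (inertiaGroup (psiBracket ψ A))) [M.Normal],
      IsCliffordSubgroup (stabSL ψ A) (psiBracket ψ A) M →
        InductionBijective (psiBracket ψ A) M := by
  have hψ_prim := isPrimitiveOver_truncMap hϖ ψ hψ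
  have : Finite (𝒪 ⧸ maximalIdeal 𝒪) := ‹Finite (IsLocalRing.ResidueField 𝒪)›
  have : Finite (TruncRing 𝒪 (2 * ℓ)) :=
    Ideal.finite_quotient_pow (IsNoetherian.noetherian (maximalIdeal 𝒪)) _
  obtain ⟨P', hP'⟩ := hA.exists_semiconjBy
  obtain ⟨P, hP⟩ := hasSquareZeroKernel_truncMap.mapMatrix.exists_units_map_eq
    (fun B => ⟨liftMatrix B, mapMatrix_liftMatrix B⟩) P'
  rw [← hP] at hP'
  exact (isCompanionModel_conjSL hψ_prim hP').existsUnique_isCliffordSubgroup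
    hasSquareZeroKernel_truncMap hψ_prim

theorem mainTheorem4 {𝒪 : Type*} [CommRing 𝒪] [IsDomain 𝒪] [IsDiscreteValuationRing 𝒪]
    [IsAdicComplete (IsLocalRing.maximalIdeal 𝒪) 𝒪]
    [Finite (IsLocalRing.ResidueField 𝒪)] [CharP (IsLocalRing.ResidueField 𝒪) 2]
    (ℓ : ℕ) (hℓ : boundR 𝒪 ≤ 2 * ℓ)
    (ϖ : 𝒪) (hϖ : Irreducible ϖ)
    (ψ : AddChar (TruncRing 𝒪 (2 * ℓ)) ℂˣ)
    (hψ : ψ (Ideal.Quotient.mk _ (ϖ ^ (2 * ℓ - 1))) ≠ 1)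
    (A : Matrix (Fin 2) (Fin 2) (TruncRing 𝒪 ℓ)) (hA : IsCyclicMatrix A) :
    (∃! M : Subgroup (inertiaGroup (psiBracket ψ A)),
      IsCliffordSubgroup (stabSL ψ A) (psiBracket ψ A) M) ∧
    ∀ (M : Subgroup (inertiaGroup (psiBracket ψ A))) [M.Normal],
      IsCliffordSubgroup (stabSL ψ A) (psiBracket ψ A) M →
        InductionBijective (psiBracket ψ A) M := by
  exact mainTheorem4_general ℓ ϖ hϖ ψ hψ A hA
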